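/- Let $R$ be a finite commutative chain ring (its ideals are totally ordered by inclusion, $1\neq 0$) with maximal ideal $\langle\pi\rangle$, residue field $R/\langle\pi\rangle$ of size $q$, and nilpotency index $s$ of $\pi$ (the least $s\ge 1$ with $\pi^s=0$). A shape is a sequence $\mu=(\mu_1,\dots,\mu_s)$ of integers with $0\le\mu_1\le\cdots\le\mu_s$; write $\mu_0=0$ for every shape, and $\lambda\preceq n,\mu$ if $\lambda_i\le n$ and $\lambda_i\le\mu_i$ for all $i$. Let $$R^\mu=\langle 1\rangle^{\mu_1}\times\langle\pi\rangle^{\mu_2-\mu_1}\times\cdots\times\langle\pi^{s-1}\rangle^{\mu_s-\mu_{s-1}}\subseteq R^{\mu_s},$$ and let $R^{n\times\mu}$ be the set of $n\times\mu_s$ matrices over $R$ whose rows lie in $R^\mu$. For $\lambda\preceq\mu$ put $$\left[\!\!\left[{\mu\atop\lambda}\right]\!\!\right]_q=\prod_{i=1}^{s}q^{(\mu_i-\lambda_i)\lambda_{i-1}}\binom{\mu_i-\lambda_{i-1}}{\lambda_i-\lambda_{i-1}}_{\!q},\qquad \binom{m}{k}_{\!q}=\prod_{i=0}^{k-1}\frac{q^m-q^i}{q^k-q^i}.$$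 Fix a complete set $T\ni 0$ of residues modulo $\pi$, and let $T_l=\{\sum_{i<l}a_i\pi^i: a_i\in T\}$ (so $T_0=\{0\}$). The degree of $a\in R$ is the largest $l\le s$ with $\pi^l\mid a$. The pivot of a nonzero row is the first (leftmost) of its entries of least degree. A matrix is in row canonical form if (1) nonzero rows are above zero rows; (2) of two pivots of equal degree the one in the earlier column is above the other, and of two pivots of different degree the one with smaller degree is above the other; (3) every pivot is $\pi^l$ for some $0\le l<s$; (4) for every pivot $\pi^l$, all entries below it in its column are $0$ and all entries above it in its column belong to $T_l$. Let $0\le n\le N$ and let $\mu$ be a shape. Consider the multiplicative matrix channel $Y=AX$ with input $X\in R^{n\times\mu}$ and output $Y\in R^{N\times\mu}$, where $A$ is independent of $X$ and uniform over the full-column-rank matrices in $R^{N\times n}$ (those whose transpose has row span isomorphic to $R^n$). Its capacity $C_{\mathrm{MMC}}=\max_{p_X}I(X;Y)$, with logarithms to base $q$, is $$C_{\mathrm{MMC}}=\log_q\sum_{\lambda\preceq n,\mu}\left[\!\!\left[{\mu\atop\lambda}\right]\!\!\right]_q .$$ A capacity-achieving code $\mathcal C\subseteq R^{n\times\mu}$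 consists of all row canonical forms in $R^{n\times\mu}$: $X$ uniform on $\mathcal C$ attains $I(X;Y)=C_{\mathrm{MMC}}$, one has $\log_q|\mathcal C|=C_{\mathrm{MMC}}$, and some decoder recovers every codeword $X\in\mathcal C$ from $Y$ with error probability zero. Moreover, this is transmission via submodules: $X\mapsto\operatorname{row}X$ is a bijection from $\mathcal C$ onto the set of all row spans of matrices in $R^{n\times\mu}$. -/

import Mathlib

namespace ChainRing

/-- `R` is a `(q, s)` chain ring with maximal ideal `⟨π⟩` (finiteness of `R` is a separate instance
argument): `R` is nonzero, its ideals form a chain, `π` generates the maximal ideal, the residue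
field `R / ⟨π⟩` has `q` elements, and `s` is the nilpotency index of `π`. -/
structure IsChainRing (R : Type*) [CommRing R] (π : R) (q s : ℕ) : Prop where
  one_ne_zero : (1 : R) ≠ 0
  chain : ∀ I J : Ideal R, I ≤ J ∨ J ≤ I
  isMaximal : (Ideal.span {π}).IsMaximal
  card_residue : Nat.card (R ⧸ Ideal.span {π}) = q
  pow_eq_zero : π ^ s = 0
  pow_ne_zero : ∀ l < s, π ^ l ≠ 0

/-- An `s`-shape: a sequence `0 ≤ μ₁ ≤ ⋯ ≤ μₛ` (indexed here by `Fin s`). -/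
def IsShape {s : ℕ} (μ : Fin s → ℕ) : Prop := ∀ i j, i ≤ j → μ i ≤ μ j

/-- The largest component `μₛ` of a shape. -/
def packetLength {s : ℕ} (μ : Fin s → ℕ) : ℕ := Finset.univ.sup μ

/-- The exponent `l` of the ideal `⟨π ^ l⟩` from which coordinate `j` (counted from `0`) of an
element of `R^μ` is taken: the number of components of `μ` that are at most `j`. Thus it is `0` on
the first `μ₁` coordinates, `1` on the next `μ₂ - μ₁` coordinates, and so on. -/
def shapeExponent {s : ℕ} (μ : Fin s → ℕ) (j : ℕ) : ℕ := (Finset.univ.filter fun i => μ i ≤ j).card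

/-- The module `R^μ`, as a submodule of the module of `m`-tuples, `m = μₛ`. -/
def shapeModule {R : Type*} [CommRing R] (π : R) {s : ℕ} (μ : Fin s → ℕ) :
    Submodule R (Fin (packetLength μ) → R) :=
  Submodule.pi Set.univ fun j => Ideal.span {π ^ shapeExponent μ (j : ℕ)}

/-- The module `M` has shape `μ`, i.e. `M ≅ R^μ`. -/
def HasShape {R : Type*} [CommRing R] (π : R) (M : Type*) [AddCommGroup M] [Module R M]
    {s : ℕ} (μ : Fin s → ℕ) : Prop :=
  Nonempty (M ≃ₗ[R] shapeModule π μ)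

/-- The set `R^{n × μ}` of matrices with `n` rows, all of them in `R^μ`. -/
abbrev ShapeMatrix {R : Type*} [CommRing R] (π : R) {s : ℕ} (n : ℕ) (μ : Fin s → ℕ) : Type _ :=
  {X : Matrix (Fin n) (Fin (packetLength μ)) R // ∀ i, X i ∈ shapeModule π μ}

noncomputable instance {R : Type*} [CommRing R] [Finite R] (π : R) {s : ℕ} (n : ℕ)
    (μ : Fin s → ℕ) : Fintype (ShapeMatrix π n μ) := Fintype.ofFinite _

/-- The row span of a matrix. -/
def rowSpan {R : Type*} [CommRing R] {n m : ℕ} (A : Matrix (Fin n) (Fin m) R) :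
    Submodule R (Fin m → R) :=
  Submodule.span R (Set.range fun i => A i)

/-- `A` has full column rank: the shape of its transpose (the shape of the row span of the
transpose) is `(n, …, n)`, where `n` is the number of columns of `A`. -/
def IsFullColumnRank {R : Type*} [CommRing R] (π : R) (s : ℕ) {N n : ℕ}
    (A : Matrix (Fin N) (Fin n) R) : Prop :=
  HasShape π (rowSpan A.transpose) (fun _ : Fin s => n)

/-! ### Row canonical forms -/

open Classical in
/-- The degree of `a`: the number of leading zeros in the `π`-adic decomposition
`a = a₀ + a₁ π + ⋯ + aₛ₋₁ π ^ (s - 1)`, i.e. the largest `l ≤ s` such that `π ^ l` divides `a`. In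
particular `0` has degree `s`. -/
noncomputable def degree {R : Type*} [CommRing R] (π : R) (s : ℕ) (a : R) : ℕ :=
  Nat.findGreatest (fun l => π ^ l ∣ a) s

/-- `T` is a complete set of residues modulo `π` that contains `0`. -/
def IsResidueSystem {R : Type*} [CommRing R] (π : R) (T : Set R) : Prop :=
  0 ∈ T ∧ ∀ a : R, ∃! r, r ∈ T ∧ π ∣ a - r

/-- The complete set of residues modulo `π ^ l` built from `T`: all `∑_{i < l} aᵢ π ^ i` with
`aᵢ ∈ T`. -/
def residuesPow {R : Type*} [CommRing R] (π : R) (T : Set R) (l : ℕ) : Set R :=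
  {x | ∃ a : Fin l → R, (∀ i, a i ∈ T) ∧ x = ∑ i, a i * π ^ (i : ℕ)}

/-- Row `i` of `A` is nonzero and its pivot, the first among its entries of least degree, is in
column `j`. -/
def IsPivot {R : Type*} [CommRing R] (π : R) (s : ℕ) {n m : ℕ} (A : Matrix (Fin n) (Fin m) R)
    (i : Fin n) (j : Fin m) : Prop :=
  A i ≠ 0 ∧ (∀ j', degree π s (A i j) ≤ degree π s (A i j')) ∧
    ∀ j' < j, degree π s (A i j) < degree π s (A i j')

/-- `A` is in row canonical form (with respect to `π` and the residue system `T`). -/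
structure IsRowCanonical {R : Type*} [CommRing R] (π : R) (s : ℕ) (T : Set R) {n m : ℕ}
    (A : Matrix (Fin n) (Fin m) R) : Prop where
  nonzero_above_zero : ∀ i i', A i ≠ 0 → A i' = 0 → i < i'
  same_degree : ∀ i i' j j', IsPivot π s A i j → IsPivot π s A i' j' →
    degree π s (A i j) = degree π s (A i' j') → j < j' → i < i'
  lower_degree : ∀ i i' j j', IsPivot π s A i j → IsPivot π s A i' j' →
    degree π s (A i j) < degree π s (A i' j') → i < i'
  pivot_eq_pow : ∀ i j, IsPivot π s A i j → ∃ l < s, A i j = π ^ l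
  below_pivot : ∀ i j, IsPivot π s A i j → ∀ i', i < i' → A i' j = 0
  above_pivot : ∀ i j, IsPivot π s A i j → ∀ l < s, A i j = π ^ l →
    ∀ i' < i, A i' j ∈ residuesPow π T l

/-! ### The counting formula -/

/-- The Gaussian coefficient. -/
noncomputable def gauss (q : ℝ) (m k : ℕ) : ℝ :=
  ∏ i ∈ Finset.range k, (q ^ m - q ^ i) / (q ^ k - q ^ i)

/-- The component `κ_{i - 1}` that precedes `κ_i`, where the zeroth component is `0`. -/
def prevComponent {s : ℕ} (κ : Fin s → ℕ) (i : Fin s) : ℕ :=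
  if (i : ℕ) = 0 then 0 else κ ⟨(i : ℕ) - 1, by omega⟩

/-- The coefficient `[μ choose κ]_q` for a subshape `κ` of `μ`, namely
`∏ᵢ q ^ ((μᵢ - κᵢ) κᵢ₋₁) [μᵢ - κᵢ₋₁ choose κᵢ - κᵢ₋₁]_q`. -/
noncomputable def shapeChoose (q : ℝ) {s : ℕ} (μ κ : Fin s → ℕ) : ℝ :=
  ∏ i, q ^ ((μ i - κ i) * prevComponent κ i) *
    gauss q (μ i - prevComponent κ i) (κ i - prevComponent κ i)

/-- The finite set of the shapes `κ ⪯ n, μ`. -/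
def subshapes {s : ℕ} (n : ℕ) (μ : Fin s → ℕ) : Finset (Fin s → ℕ) :=
  (Fintype.piFinset fun i => Finset.range (min n (μ i) + 1)).filter
    fun κ => ∀ i j, i ≤ j → κ i ≤ κ j

/-! ### Discrete memoryless channels -/

/-- The mutual information `I(X; Y)`, in units of base-`b` logarithms, for input distribution `p`
and transition probabilities `W x y = p_{Y|X}(y | x)` on finite alphabets. -/
noncomputable def mutualInfo {α β : Type*} [Fintype α] [Fintype β] (b : ℝ) (p : α → ℝ)
    (W : α → β → ℝ) : ℝ :=
  ∑ x, ∑ y, p x * W x y * Real.logb b (W x y / ∑ x', p x' * W x' y)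

/-- `C` is the capacity `max_p I(X; Y)` of the channel `W`, over all input distributions `p`. -/
def IsCapacity {α β : Type*} [Fintype α] [Fintype β] (b : ℝ) (W : α → β → ℝ) (C : ℝ) : Prop :=
  IsGreatest ((fun p => mutualInfo b p W) '' stdSimplex ℝ α) C

/-- The uniform distribution on a set of inputs. -/
noncomputable def uniformOn {α : Type*} (S : Set α) : α → ℝ :=
  S.indicator fun _ => (S.ncard : ℝ)⁻¹

open Classical in
/-- The probability that the decoder `D` errs when `x` is sent. -/
noncomputable def errorProb {α β : Type*} [Fintype β] (W : α → β → ℝ) (D : β → α) (x : α) : ℝ :=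
  ∑ y, if D y = x then 0 else W x y

/-- The transition probabilities of the multiplicative matrix channel `Y = A X`, with `A` uniform
over the full-column-rank matrices in `R^{N × n}` and independent of `X`. -/
noncomputable def mmc {R : Type*} [CommRing R] (π : R) {s : ℕ} (N n : ℕ) (μ : Fin s → ℕ)
    (X : ShapeMatrix π n μ) (Y : ShapeMatrix π N μ) : ℝ :=
  (Nat.card {A : Matrix (Fin N) (Fin n) R // IsFullColumnRank π s A ∧ A * X.1 = Y.1} : ℝ) /
    (Nat.card {A : Matrix (Fin N) (Fin n) R // IsFullColumnRank π s A} : ℝ)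

/-- The code of all row canonical forms in `R^{n × μ}`. -/
def rowCanonicalCode {R : Type*} [CommRing R] (π : R) {s : ℕ} (T : Set R) (n : ℕ)
    (μ : Fin s → ℕ) : Set (ShapeMatrix π n μ) :=
  {X | IsRowCanonical π s T X.1}

end ChainRing

open ChainRing

/-! The channel conveys exactly the row span of its input. A full-column-rank `A` has a left inverse
(`IsFullColumnRank.exists_leftInverse`), so `row (A X) = row X` and the output determines the row
span. Conversely, inputs with equal row spans differ by an invertible left factor `U`
(`rowEquiv_of_rowSpan_eq`), and `A ↦ A U` permutes the full-column-rank matrices, so both inputs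
have the same output law. For such a channel `I(X; Y)` is the entropy of the class `row X`
(`IsClassChannel.mutualInfo_eq`). Its maximum is the logarithm of the number of row spans, attained
by the uniform law on any set of representatives, and decoding is exact on representatives.

Row canonical forms are representatives. Existence is Gaussian elimination with a pivot of least
degree. Uniqueness is by induction on the number of rows: the degree and column of the first pivot,
and the span of the remaining rows, can be read off the row span, after which the first row is fixed
by uniqueness of residues.

It remains to count row spans, that is, submodules `L` of `M = R^μ` with at most `n` generators. By
Nakayama the minimal number of generators is the dimension of `L / πL`, which has the size of the
socle of `L`. The shape of `L` records the socle dimensions of all `π ^ i L`, and the count peels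
off one power of `π` at a time. Fix `L' = πL` with socle dimension `a`, and let the socles of `L`
and `M` have dimensions `l` and `w`. The socle of `L` is one of `gauss q (w - a) (l - a)` subspaces
between the two socles (`natCard_between`). Once it is fixed, lifting `a` minimal generators of `L'`
gives `q ^ ((w - l) * a)` choices of `L` (`natCard_with_socle`). The product over all levels is
`shapeChoose`. -/

namespace ChainRing

/-! ### Arithmetic in a chain ring. -/

section Basics

variable {R : Type*} [CommRing R] {π : R} {q s : ℕ}

theorem pow_degree_dvd (π : R) (s : ℕ) (a : R) : π ^ degree π s a ∣ a := by
  classical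
  exact Nat.findGreatest_spec (P := fun l => π ^ l ∣ a) (Nat.zero_le s) (by simp)

theorem degree_le (π : R) (s : ℕ) (a : R) : degree π s a ≤ s := by
  classical
  exact Nat.findGreatest_le s

theorem pow_dvd_iff_le_degree {l : ℕ} (hl : l ≤ s) (a : R) : π ^ l ∣ a ↔ l ≤ degree π s a := by
  classical
  exact ⟨fun h => Nat.le_findGreatest hl h,
    fun h => (pow_dvd_pow π h).trans (pow_degree_dvd π s a)⟩

theorem degree_zero (π : R) (s : ℕ) : degree π s (0 : R) = s :=
  le_antisymm (degree_le π s 0) ((pow_dvd_iff_le_degree le_rfl _).1 (dvd_zero _))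

namespace IsChainRing

variable (hR : IsChainRing R π q s)
include hR

theorem pos : 0 < s := by
  rcases Nat.eq_zero_or_pos s with h | h
  · have := hR.pow_eq_zero
    rw [h, pow_zero] at this
    exact absurd this hR.one_ne_zero
  · exact h

/-- By the chain condition `⟨a⟩` contains `⟨π⟩`, properly, so maximality makes it the whole ring. -/
theorem isUnit_of_not_dvd {a : R} (h : ¬ π ∣ a) : IsUnit a := by
  have h1 : ¬ Ideal.span {a} ≤ Ideal.span {π} := by
    rwa [Ideal.span_singleton_le_span_singleton]
  have h2 := (hR.chain (Ideal.span {a}) (Ideal.span {π})).resolve_left h1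
  rcases hR.isMaximal.eq_of_le (J := Ideal.span {a}) with h3
  by_contra h4
  exact h1 (h3 (by rwa [Ne, Ideal.span_singleton_eq_top]) h2).ge

theorem pow_dvd_pow_iff {k l : ℕ} (hl : l < s) : π ^ k ∣ π ^ l ↔ k ≤ l := by
  refine ⟨fun h => ?_, pow_dvd_pow π⟩
  by_contra! hk
  obtain ⟨c, hc⟩ := h
  -- If `k > l`, the factor `1 - π ^ (k - l) * c` is one minus a nilpotent, hence a unit, which
  -- would force `π ^ l = 0`.
  have h1 : π ^ l * (1 - π ^ (k - l) * c) = 0 := by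
    have : π ^ k = π ^ l * π ^ (k - l) := by rw [← pow_add]; congr 1; omega
    rw [this] at hc
    linear_combination hc
  have h2 : IsNilpotent (π ^ (k - l) * c) := by
    refine ((Commute.all _ _).isNilpotent_mul_right ?_)
    exact (show IsNilpotent π from ⟨s, hR.pow_eq_zero⟩).pow_of_pos (by omega)
  have h3 := h2.isUnit_one_sub
  exact hR.pow_ne_zero l hl (h3.mul_left_eq_zero.1 h1)

theorem degree_pow {l : ℕ} (hl : l < s) : degree π s (π ^ l) = l := by
  apply le_antisymm
  · exact (hR.pow_dvd_pow_iff hl).1 (pow_degree_dvd π s _)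
  · exact (pow_dvd_iff_le_degree hl.le _).1 dvd_rfl

theorem eq_zero_of_pow_dvd {a : R} (h : π ^ s ∣ a) : a = 0 := by
  rwa [hR.pow_eq_zero, zero_dvd_iff] at h

theorem degree_lt_iff {a : R} : degree π s a < s ↔ a ≠ 0 := by
  constructor
  · rintro h rfl
    rw [degree_zero] at h
    exact h.false
  · intro h
    refine lt_of_le_of_ne (degree_le π s a) fun h1 => h ?_
    exact hR.eq_zero_of_pow_dvd ((pow_dvd_iff_le_degree le_rfl a).2 h1.ge)

/-- After the largest power of `π` is extracted, the cofactor is not divisible by `π` and so is a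
unit. For `a = 0` the degree is `s` and `π ^ s = 0`. -/
theorem exists_unit_mul_pow (a : R) : ∃ u : Rˣ, a = u * π ^ degree π s a := by
  by_cases ha : a = 0
  · subst ha
    exact ⟨1, by rw [degree_zero, hR.pow_eq_zero, mul_zero]⟩
  · have hd := hR.degree_lt_iff.2 ha
    obtain ⟨b, hb⟩ := pow_degree_dvd π s a
    have : ¬ π ∣ b := by
      rintro ⟨c, rfl⟩
      have h1 : π ^ (degree π s a + 1) ∣ a := ⟨c, by rw [pow_succ, mul_assoc]; exact hb⟩
      have := (pow_dvd_iff_le_degree (s := s) (l := degree π s a + 1) (by omega) a).1 h1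
      omega
    obtain ⟨u, rfl⟩ := hR.isUnit_of_not_dvd this
    exact ⟨u, by rw [mul_comm]; exact hb⟩

theorem dvd_of_pow_mul_eq_zero {l : ℕ} {a : R} (h : π ^ l * a = 0) : π ^ (s - l) ∣ a := by
  obtain ⟨u, hu⟩ := hR.exists_unit_mul_pow a
  have h1 : π ^ (l + degree π s a) = 0 := by
    rw [hu] at h
    rw [pow_add]
    refine u.isUnit.mul_right_eq_zero.1 (b := _) ?_
    linear_combination h
  rw [pow_dvd_iff_le_degree (Nat.sub_le s l)]
  by_contra! h2
  exact hR.pow_ne_zero _ (by omega) h1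

theorem dvd_of_pow_succ_dvd_mul {l : ℕ} (hl : l < s) {a : R} (h : π ^ (l + 1) ∣ a * π ^ l) :
    π ∣ a := by
  by_contra h1
  obtain ⟨u, rfl⟩ := hR.isUnit_of_not_dvd h1
  have : π ^ (l + 1) ∣ π ^ l := u.isUnit.dvd_mul_left.1 h
  have := (hR.pow_dvd_pow_iff hl).1 this
  omega

end IsChainRing

/-! ### Residues modulo powers of `π` -/

theorem mem_residuesPow_succ {T : Set R} {l : ℕ} {x : R} :
    x ∈ residuesPow π T (l + 1) ↔ ∃ y ∈ residuesPow π T l, ∃ a ∈ T, x = y + a * π ^ l := by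
  constructor
  · rintro ⟨a, ha, rfl⟩
    refine ⟨_, ⟨fun i => a i.castSucc, fun i => ha _, rfl⟩, a (Fin.last l), ha _, ?_⟩
    simp [Fin.sum_univ_castSucc]
  · rintro ⟨_, ⟨a, ha, rfl⟩, b, hb, rfl⟩
    refine ⟨Fin.snoc (α := fun _ => R) a b, fun i => ?_, ?_⟩
    · refine Fin.lastCases ?_ (fun i => ?_) i <;> simp [ha, hb]
    · simp [Fin.sum_univ_castSucc]

theorem zero_mem_residuesPow {T : Set R} (hT : IsResidueSystem π T) (l : ℕ) :
    (0 : R) ∈ residuesPow π T l :=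
  ⟨fun _ => 0, fun _ => hT.1, by simp⟩

theorem exists_add_mul_mem_residuesPow {T : Set R} (hT : IsResidueSystem π T) (l : ℕ) (a : R) :
    ∃ c, a + c * π ^ l ∈ residuesPow π T l := by
  induction l with
  | zero => exact ⟨-a, by simpa using zero_mem_residuesPow hT 0⟩
  | succ l ih =>
    obtain ⟨c, hc⟩ := ih
    -- With `a = y - c π ^ l` and `y` already in `T_l`, the next digit of `a` is the residue of
    -- `-c`.
    obtain ⟨r, ⟨hr, t, ht⟩, -⟩ := hT.2 (-c)
    refine ⟨-t, mem_residuesPow_succ.2 ⟨_, hc, r, hr, ?_⟩⟩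
    rw [pow_succ]
    linear_combination π ^ l * ht

theorem residuesPow_injective (hR : IsChainRing R π q s) {T : Set R} (hT : IsResidueSystem π T)
    {l : ℕ} (hl : l ≤ s) {x y : R} (hx : x ∈ residuesPow π T l) (hy : y ∈ residuesPow π T l)
    (h : π ^ l ∣ x - y) : x = y := by
  induction l generalizing x y with
  | zero =>
    obtain ⟨a, -, rfl⟩ := hx
    obtain ⟨b, -, rfl⟩ := hy
    simp
  | succ l ih =>
    obtain ⟨x', hx', a, ha, rfl⟩ := mem_residuesPow_succ.1 hx
    obtain ⟨y', hy', b, hb, rfl⟩ := mem_residuesPow_succ.1 hy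
    have h1 : π ^ l ∣ x' - y' := by
      have h2 : π ^ l ∣ (x' + a * π ^ l - (y' + b * π ^ l)) :=
        (pow_dvd_pow π (Nat.le_succ l)).trans h
      have h3 : π ^ l ∣ (a - b) * π ^ l := Dvd.intro_left _ rfl
      convert dvd_sub h2 h3 using 1
      ring
    obtain rfl := ih (by omega) hx' hy' h1
    have h2 : π ∣ a - b := by
      apply hR.dvd_of_pow_succ_dvd_mul (show l < s by omega)
      convert h using 1
      ring
    have := (hT.2 a).unique ⟨ha, by simp⟩ ⟨hb, h2⟩
    rw [this]

end Basics

/-! ### Row operations -/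

section Rows

variable {R : Type*} {n m : ℕ}

/-- The matrix with first row `v` and remaining rows `A`. -/
def consRow (v : Fin m → R) (A : Matrix (Fin n) (Fin m) R) : Matrix (Fin (n + 1)) (Fin m) R :=
  Matrix.of (Fin.cons v A)

/-- The matrix without its first row. -/
def tailRows (A : Matrix (Fin (n + 1)) (Fin m) R) : Matrix (Fin n) (Fin m) R :=
  Matrix.of fun i => A i.succ

@[simp] theorem consRow_zero (v : Fin m → R) (A : Matrix (Fin n) (Fin m) R) :
    consRow v A 0 = v := rfl

@[simp] theorem consRow_succ (v : Fin m → R) (A : Matrix (Fin n) (Fin m) R) (i : Fin n) :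
    consRow v A i.succ = A i := rfl

@[simp] theorem tailRows_apply (A : Matrix (Fin (n + 1)) (Fin m) R) (i : Fin n) :
    tailRows A i = A i.succ := rfl

end Rows

section RowEquiv

variable {R : Type*} [CommRing R] {n m : ℕ}

/-- `B` arises from `A` by invertible row operations. -/
def RowEquiv (A B : Matrix (Fin n) (Fin m) R) : Prop :=
  ∃ U V : Matrix (Fin n) (Fin n) R, U * V = 1 ∧ V * U = 1 ∧ B = U * A

theorem RowEquiv.refl (A : Matrix (Fin n) (Fin m) R) : RowEquiv A A := ⟨1, 1, by simp⟩

theorem RowEquiv.trans {A B C : Matrix (Fin n) (Fin m) R} (h : RowEquiv A B)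
    (h' : RowEquiv B C) : RowEquiv A C := by
  obtain ⟨U, V, h1, h2, rfl⟩ := h
  obtain ⟨U', V', h1', h2', rfl⟩ := h'
  refine ⟨U' * U, V * V', ?_, ?_, by rw [Matrix.mul_assoc]⟩
  · rw [Matrix.mul_assoc, ← Matrix.mul_assoc U, h1, Matrix.one_mul, h1']
  · rw [Matrix.mul_assoc, ← Matrix.mul_assoc V', h2', Matrix.one_mul, h2]

theorem RowEquiv.symm {A B : Matrix (Fin n) (Fin m) R} (h : RowEquiv A B) : RowEquiv B A := by
  obtain ⟨U, V, h1, h2, rfl⟩ := h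
  exact ⟨V, U, h2, h1, by rw [← Matrix.mul_assoc, h2, Matrix.one_mul]⟩

theorem mem_rowSpan {A : Matrix (Fin n) (Fin m) R} {v : Fin m → R} :
    v ∈ rowSpan A ↔ ∃ c : Fin n → R, v = ∑ i, c i • A i := by
  rw [rowSpan, Submodule.mem_span_range_iff_exists_fun]
  simp only [eq_comm]

theorem row_mem_rowSpan (A : Matrix (Fin n) (Fin m) R) (i : Fin n) : A i ∈ rowSpan A :=
  Submodule.subset_span ⟨i, rfl⟩

theorem rowSpan_mul_le {k : ℕ} (U : Matrix (Fin k) (Fin n) R) (A : Matrix (Fin n) (Fin m) R) :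
    rowSpan (U * A) ≤ rowSpan A := by
  refine Submodule.span_le.2 ?_
  rintro _ ⟨i, rfl⟩
  refine mem_rowSpan.2 ⟨U i, ?_⟩
  ext j
  simp [Matrix.mul_apply]

theorem rowSpan_mul_of_leftInverse {k : ℕ} {U : Matrix (Fin k) (Fin n) R}
    {V : Matrix (Fin n) (Fin k) R} (h : V * U = 1) (A : Matrix (Fin n) (Fin m) R) :
    rowSpan (U * A) = rowSpan A := by
  refine le_antisymm (rowSpan_mul_le U A) ?_
  have := rowSpan_mul_le V (U * A)
  rwa [← Matrix.mul_assoc, h, Matrix.one_mul] at this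

theorem RowEquiv.rowSpan_eq {A B : Matrix (Fin n) (Fin m) R} (h : RowEquiv A B) :
    rowSpan A = rowSpan B := by
  obtain ⟨U, V, h1, h2, rfl⟩ := h
  exact (rowSpan_mul_of_leftInverse h2 A).symm

theorem rowEquiv_permute (σ : Equiv.Perm (Fin n)) (A : Matrix (Fin n) (Fin m) R) :
    RowEquiv A (A.submatrix σ id) := by
  refine ⟨(1 : Matrix (Fin n) (Fin n) R).submatrix σ id,
    (1 : Matrix (Fin n) (Fin n) R).submatrix id σ, ?_, ?_, ?_⟩
  · ext i j
    simp [Matrix.mul_apply, Matrix.one_apply]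
  · ext i j
    simp only [Matrix.mul_apply, Matrix.submatrix_apply, id, Matrix.one_apply]
    rw [Equiv.sum_comp σ (fun k => (if i = k then (1 : R) else 0) * if k = j then 1 else 0)]
    simp
  · ext i j
    simp [Matrix.mul_apply, Matrix.one_apply]

/-- The multiples added below are of the original first row, not of the scaled one; this accounts
for the entries `-a i * u⁻¹` of the inverse. -/
theorem rowEquiv_clear (u : Rˣ) (a : Fin n → R) (A : Matrix (Fin (n + 1)) (Fin m) R) :
    RowEquiv A (consRow ((u : R) • A 0) (Matrix.of fun i => A i.succ + a i • A 0)) := by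
  refine ⟨Matrix.of (Fin.cons (Fin.cons (u : R) 0)
      fun i => Fin.cons (a i) ((1 : Matrix (Fin n) (Fin n) R) i)),
    Matrix.of (Fin.cons (Fin.cons ((u⁻¹ : Rˣ) : R) 0)
      fun i => Fin.cons (-a i * ((u⁻¹ : Rˣ) : R)) ((1 : Matrix (Fin n) (Fin n) R) i)), ?_, ?_, ?_⟩
  · ext i j
    refine Fin.cases ?_ (fun i => ?_) i <;> refine Fin.cases ?_ (fun j => ?_) j <;>
      simp [Matrix.mul_apply, Fin.sum_univ_succ, Matrix.one_apply, eq_comm]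
  · ext i j
    refine Fin.cases ?_ (fun i => ?_) i <;> refine Fin.cases ?_ (fun j => ?_) j <;>
      simp [Matrix.mul_apply, Fin.sum_univ_succ, Matrix.one_apply, eq_comm]
  · ext i j
    refine Fin.cases ?_ (fun i => ?_) i <;>
      simp [Matrix.mul_apply, Fin.sum_univ_succ, Matrix.one_apply, add_comm]

theorem rowEquiv_reduce (c : Fin n → R) (A : Matrix (Fin (n + 1)) (Fin m) R) :
    RowEquiv A (consRow (A 0 + ∑ i, c i • A i.succ) (tailRows A)) := by
  refine ⟨Matrix.of (Fin.cons (Fin.cons 1 c)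
      fun i => Fin.cons 0 ((1 : Matrix (Fin n) (Fin n) R) i)),
    Matrix.of (Fin.cons (Fin.cons 1 (-c))
      fun i => Fin.cons 0 ((1 : Matrix (Fin n) (Fin n) R) i)), ?_, ?_, ?_⟩
  · ext i j
    refine Fin.cases ?_ (fun i => ?_) i <;> refine Fin.cases ?_ (fun j => ?_) j <;>
      simp [Matrix.mul_apply, Fin.sum_univ_succ, Matrix.one_apply, eq_comm]
  · ext i j
    refine Fin.cases ?_ (fun i => ?_) i <;> refine Fin.cases ?_ (fun j => ?_) j <;>
      simp [Matrix.mul_apply, Fin.sum_univ_succ, Matrix.one_apply, eq_comm]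
  · ext i j
    refine Fin.cases ?_ (fun i => ?_) i <;>
      simp [Matrix.mul_apply, Fin.sum_univ_succ, Matrix.one_apply]

theorem rowEquiv_consRow {A B : Matrix (Fin n) (Fin m) R} (h : RowEquiv A B) (v : Fin m → R) :
    RowEquiv (consRow v A) (consRow v B) := by
  obtain ⟨U, V, h1, h2, rfl⟩ := h
  have e1 := fun i j => congrFun (congrFun h1 i) j
  have e2 := fun i j => congrFun (congrFun h2 i) j
  simp only [Matrix.mul_apply, Matrix.one_apply] at e1 e2
  refine ⟨Matrix.of (Fin.cons (Fin.cons 1 0) fun i => Fin.cons 0 (U i)),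
    Matrix.of (Fin.cons (Fin.cons 1 0) fun i => Fin.cons 0 (V i)), ?_, ?_, ?_⟩
  · ext i j
    refine Fin.cases ?_ (fun i => ?_) i <;> refine Fin.cases ?_ (fun j => ?_) j <;>
      simp [Matrix.mul_apply, Fin.sum_univ_succ, Matrix.one_apply, e1, (Fin.succ_ne_zero _).symm]
  · ext i j
    refine Fin.cases ?_ (fun i => ?_) i <;> refine Fin.cases ?_ (fun j => ?_) j <;>
      simp [Matrix.mul_apply, Fin.sum_univ_succ, Matrix.one_apply, e2, (Fin.succ_ne_zero _).symm]
  · ext i j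
    refine Fin.cases ?_ (fun i => ?_) i <;>
      simp [Matrix.mul_apply, Fin.sum_univ_succ]

theorem mem_rowSpan_succ {A : Matrix (Fin (n + 1)) (Fin m) R} {v : Fin m → R} :
    v ∈ rowSpan A ↔ ∃ c : R, ∃ w ∈ rowSpan (tailRows A), v = c • A 0 + w := by
  constructor
  · intro h
    obtain ⟨c, rfl⟩ := mem_rowSpan.1 h
    exact ⟨c 0, _, mem_rowSpan.2 ⟨fun i => c i.succ, rfl⟩, Fin.sum_univ_succ _⟩
  · rintro ⟨c, w, hw, rfl⟩
    obtain ⟨c', rfl⟩ := mem_rowSpan.1 hw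
    exact mem_rowSpan.2 ⟨Fin.cons c c', by simp [Fin.sum_univ_succ]⟩

theorem dvd_of_mem_rowSpan {A : Matrix (Fin n) (Fin m) R} {a : R} {j : Fin m}
    (h : ∀ i, a ∣ A i j) {v : Fin m → R} (hv : v ∈ rowSpan A) : a ∣ v j := by
  obtain ⟨c, rfl⟩ := mem_rowSpan.1 hv
  rw [Finset.sum_apply]
  exact Finset.dvd_sum fun i _ => Dvd.dvd.mul_left (h i) _

end RowEquiv

/-! ### Row canonical forms and their recursive structure. -/

section RowCanonical

variable {R : Type*} [CommRing R] {π : R} {q s : ℕ} {n m : ℕ}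

/-- The first row of `A` has pivot `π ^ d` in column `j`; this entry has least degree in the whole
matrix, is leftmost with this property, and column `j` is zero below it. -/
structure IsHead (π : R) (s : ℕ) (A : Matrix (Fin (n + 1)) (Fin m) R) (d : ℕ) (j : Fin m) :
    Prop where
  lt : d < s
  head : A 0 j = π ^ d
  below : ∀ i, tailRows A i j = 0
  dvd : ∀ i j', π ^ d ∣ A i j'
  dvd_left : ∀ i, ∀ j' < j, π ^ (d + 1) ∣ A i j'

theorem IsPivot.unique {A : Matrix (Fin n) (Fin m) R} {i : Fin n} {j j' : Fin m}
    (h : IsPivot π s A i j) (h' : IsPivot π s A i j') : j = j' := by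
  rcases lt_trichotomy j j' with h1 | h1 | h1
  · exact absurd (h'.2.2 j h1) (not_lt.2 (h.2.1 j'))
  · exact h1
  · exact absurd (h.2.2 j' h1) (not_lt.2 (h'.2.1 j))

theorem exists_isPivot {A : Matrix (Fin n) (Fin m) R} {i : Fin n} (h : A i ≠ 0) :
    ∃ j, IsPivot π s A i j := by
  obtain ⟨j0, -⟩ := Function.ne_iff.1 h
  classical
  obtain ⟨j1, -, hj1⟩ := Finset.exists_min_image Finset.univ (fun j => degree π s (A i j))
    ⟨j0, Finset.mem_univ _⟩
  let S := Finset.univ.filter fun j => degree π s (A i j) ≤ degree π s (A i j1)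
  have hS : S.Nonempty := ⟨j1, by simp [S]⟩
  have hmin := Finset.min'_mem S hS
  simp only [S, Finset.mem_filter, Finset.mem_univ, true_and] at hmin
  refine ⟨S.min' hS, h, fun j' => hmin.trans (hj1 j' (Finset.mem_univ _)), fun j' hj' => ?_⟩
  by_contra! hlt
  exact absurd (S.min'_le j' (by simpa [S] using hlt.trans hmin)) (not_le.2 hj')

theorem IsPivot.degree_lt (hR : IsChainRing R π q s) {A : Matrix (Fin n) (Fin m) R} {i : Fin n}
    {j : Fin m} (h : IsPivot π s A i j) : degree π s (A i j) < s := by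
  obtain ⟨j', hj'⟩ := Function.ne_iff.1 h.1
  exact (h.2.1 j').trans_lt (hR.degree_lt_iff.2 hj')

namespace IsHead

theorem isPivot (hR : IsChainRing R π q s) {A : Matrix (Fin (n + 1)) (Fin m) R} {d : ℕ}
    {j : Fin m} (h : IsHead π s A d j) : IsPivot π s A 0 j := by
  have hd := hR.degree_pow h.lt
  refine ⟨fun h0 => hR.pow_ne_zero d h.lt (by rw [← h.head, h0]; rfl), fun j' => ?_,
    fun j' hj' => ?_⟩
  · rw [h.head, hd]
    exact (pow_dvd_iff_le_degree h.lt.le _).1 (h.dvd 0 j')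
  · rw [h.head, hd]
    exact (pow_dvd_iff_le_degree h.lt _).1 (h.dvd_left 0 j' hj')

theorem le_degree {A : Matrix (Fin (n + 1)) (Fin m) R} {d : ℕ} {j : Fin m}
    (h : IsHead π s A d j) (i j') : d ≤ degree π s (A i j') :=
  (pow_dvd_iff_le_degree h.lt.le _).1 (h.dvd i j')

/-- Column `j` vanishes below the head, and everything to its left has degree above `d`, so a later
pivot of degree `d` has only the right side left. -/
theorem lt_of_isPivot_tailRows (hR : IsChainRing R π q s) {A : Matrix (Fin (n + 1)) (Fin m) R}
    {d : ℕ} {j : Fin m} (h : IsHead π s A d j) {i : Fin n} {j' : Fin m}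
    (hp : IsPivot π s (tailRows A) i j') (hd : degree π s (tailRows A i j') = d) : j < j' := by
  rcases lt_trichotomy j j' with h1 | h1 | h1
  · exact h1
  · subst h1
    have := hp.degree_lt hR
    rw [h.below, degree_zero] at this
    exact absurd this (lt_irrefl _)
  · have := (pow_dvd_iff_le_degree h.lt _).1 (h.dvd_left i.succ j' h1)
    rw [tailRows_apply] at hd
    omega

end IsHead

theorem IsRowCanonical.tailRows {T : Set R} {A : Matrix (Fin (n + 1)) (Fin m) R}
    (h : IsRowCanonical π s T A) : IsRowCanonical π s T (tailRows A) where
  nonzero_above_zero i i' h1 h2 :=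
    Fin.succ_lt_succ_iff.1 (h.nonzero_above_zero i.succ i'.succ h1 h2)
  same_degree i i' j j' h1 h2 h3 h4 :=
    Fin.succ_lt_succ_iff.1 (h.same_degree i.succ i'.succ j j' h1 h2 h3 h4)
  lower_degree i i' j j' h1 h2 h3 :=
    Fin.succ_lt_succ_iff.1 (h.lower_degree i.succ i'.succ j j' h1 h2 h3)
  pivot_eq_pow i j h1 := h.pivot_eq_pow i.succ j h1
  below_pivot i j h1 i' h2 := h.below_pivot i.succ j h1 i'.succ (Fin.succ_lt_succ_iff.2 h2)
  above_pivot i j h1 l hl h2 i' h3 :=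
    h.above_pivot i.succ j h1 l hl h2 i'.succ (Fin.succ_lt_succ_iff.2 h3)

/-- The entries of `v` in the pivot columns of `B` are reduced modulo the pivots. -/
def IsReduced (π : R) (s : ℕ) (T : Set R) (B : Matrix (Fin n) (Fin m) R) (v : Fin m → R) : Prop :=
  ∀ i j, IsPivot π s B i j → ∀ l < s, B i j = π ^ l → v j ∈ residuesPow π T l

theorem isRowCanonical_zero (T : Set R) :
    IsRowCanonical π s T (0 : Matrix (Fin n) (Fin m) R) where
  nonzero_above_zero _ _ h1 := absurd rfl h1
  same_degree _ _ _ _ h1 := absurd rfl h1.1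
  lower_degree _ _ _ _ h1 := absurd rfl h1.1
  pivot_eq_pow _ _ h1 := absurd rfl h1.1
  below_pivot _ _ h1 := absurd rfl h1.1
  above_pivot _ _ h1 := absurd rfl h1.1

/-- Together with `IsRowCanonical.exists_isHead`, `IsRowCanonical.tailRows` and
`IsRowCanonical.isReduced`, this makes a nonzero canonical form the same as a head, a canonical tail
and a first row reduced modulo the tail. All inductions on the number of rows rest on this. -/
theorem IsHead.isRowCanonical (hR : IsChainRing R π q s) {T : Set R}
    {A : Matrix (Fin (n + 1)) (Fin m) R} {d : ℕ} {j : Fin m} (h : IsHead π s A d j)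
    (hA : IsRowCanonical π s T (ChainRing.tailRows A))
    (hred : IsReduced π s T (ChainRing.tailRows A) (A 0)) :
    IsRowCanonical π s T A where
  nonzero_above_zero i i' h1 h2 := by
    rcases Fin.eq_zero_or_eq_succ i' with rfl | ⟨i', rfl⟩
    · exact absurd h2 (h.isPivot hR).1
    rcases Fin.eq_zero_or_eq_succ i with rfl | ⟨i, rfl⟩
    · exact Fin.succ_pos _
    · exact Fin.succ_lt_succ_iff.2 (hA.nonzero_above_zero i i' h1 h2)
  same_degree i i' j1 j2 h1 h2 h3 h4 := by
    rcases Fin.eq_zero_or_eq_succ i' with rfl | ⟨i', rfl⟩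
    · obtain rfl := h2.unique (h.isPivot hR)
      rcases Fin.eq_zero_or_eq_succ i with rfl | ⟨i, rfl⟩
      · exact absurd (h1.unique h2) h4.ne
      · rw [h.head, hR.degree_pow h.lt] at h3
        exact absurd (h.lt_of_isPivot_tailRows hR h1 h3) (not_lt.2 h4.le)
    rcases Fin.eq_zero_or_eq_succ i with rfl | ⟨i, rfl⟩
    · exact Fin.succ_pos _
    · exact Fin.succ_lt_succ_iff.2 (hA.same_degree i i' j1 j2 h1 h2 h3 h4)
  lower_degree i i' j1 j2 h1 h2 h3 := by
    rcases Fin.eq_zero_or_eq_succ i' with rfl | ⟨i', rfl⟩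
    · obtain rfl := h2.unique (h.isPivot hR)
      rw [h.head, hR.degree_pow h.lt] at h3
      exact absurd (h.le_degree i j1) (not_le.2 h3)
    rcases Fin.eq_zero_or_eq_succ i with rfl | ⟨i, rfl⟩
    · exact Fin.succ_pos _
    · exact Fin.succ_lt_succ_iff.2 (hA.lower_degree i i' j1 j2 h1 h2 h3)
  pivot_eq_pow i j1 h1 := by
    rcases Fin.eq_zero_or_eq_succ i with rfl | ⟨i, rfl⟩
    · obtain rfl := h1.unique (h.isPivot hR)
      exact ⟨d, h.lt, h.head⟩
    · exact hA.pivot_eq_pow i j1 h1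
  below_pivot i j1 h1 i' h2 := by
    rcases Fin.eq_zero_or_eq_succ i' with rfl | ⟨i', rfl⟩
    · exact absurd h2 (Fin.not_lt_zero _)
    rcases Fin.eq_zero_or_eq_succ i with rfl | ⟨i, rfl⟩
    · obtain rfl := h1.unique (h.isPivot hR)
      exact h.below i'
    · exact hA.below_pivot i j1 h1 i' (Fin.succ_lt_succ_iff.1 h2)
  above_pivot i j1 h1 l hl h2 i' h3 := by
    rcases Fin.eq_zero_or_eq_succ i with rfl | ⟨i, rfl⟩
    · exact absurd h3 (Fin.not_lt_zero _)
    rcases Fin.eq_zero_or_eq_succ i' with rfl | ⟨i', rfl⟩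
    · exact hred i j1 h1 l hl h2
    · exact hA.above_pivot i j1 h1 l hl h2 i' (Fin.succ_lt_succ_iff.1 h3)

theorem IsRowCanonical.isReduced {T : Set R} {A : Matrix (Fin (n + 1)) (Fin m) R}
    (h : IsRowCanonical π s T A) : IsReduced π s T (ChainRing.tailRows A) (A 0) :=
  fun i j h1 l hl h2 => h.above_pivot i.succ j h1 l hl h2 0 (Fin.succ_pos _)

theorem IsRowCanonical.exists_isHead (hR : IsChainRing R π q s) {T : Set R}
    {A : Matrix (Fin (n + 1)) (Fin m) R} (h : IsRowCanonical π s T A) (hA : A ≠ 0) :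
    ∃ d j, IsHead π s A d j := by
  have h0 : A 0 ≠ 0 := by
    intro h0
    obtain ⟨i, hi⟩ := Function.ne_iff.1 hA
    exact Fin.not_lt_zero _ (h.nonzero_above_zero i 0 hi h0)
  obtain ⟨j, hj⟩ := exists_isPivot (π := π) (s := s) h0
  obtain ⟨d, hd, hdj⟩ := h.pivot_eq_pow 0 j hj
  have hdeg : degree π s (A 0 j) = d := by rw [hdj, hR.degree_pow hd]
  have key : ∀ i j', (d ≤ degree π s (A i j')) ∧ (j' < j → d + 1 ≤ degree π s (A i j')) := by
    intro i j'
    rcases Fin.eq_zero_or_eq_succ i with rfl | ⟨i, rfl⟩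
    · exact ⟨hdeg ▸ hj.2.1 j', fun hlt => hdeg ▸ hj.2.2 j' hlt⟩
    by_cases hi : A i.succ = 0
    · rw [hi, Pi.zero_apply, degree_zero]
      exact ⟨hd.le, fun _ => hd⟩
    obtain ⟨j1, hj1⟩ := exists_isPivot (π := π) (s := s) hi
    have hle : d ≤ degree π s (A i.succ j1) := by
      by_contra! hlt
      exact Fin.not_lt_zero _ (h.lower_degree i.succ 0 j1 j hj1 hj (hdeg.symm ▸ hlt))
    refine ⟨hle.trans (hj1.2.1 j'), fun hlt => ?_⟩
    rcases hle.lt_or_eq with hlt' | heq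
    · exact Nat.succ_le_of_lt (hlt'.trans_le (hj1.2.1 j'))
    · rcases lt_trichotomy j j1 with h1 | h1 | h1
      · rw [heq]
        exact Nat.succ_le_of_lt (hj1.2.2 j' (hlt.trans h1))
      · subst h1
        rw [h.below_pivot 0 j hj i.succ (Fin.succ_pos _), degree_zero] at heq
        omega
      · exact absurd (h.same_degree i.succ 0 j1 j hj1 hj (by rw [hdeg, heq]) h1)
          (Fin.not_lt_zero _)
  exact ⟨d, j, hd, hdj, fun i => h.below_pivot 0 j hj i.succ (Fin.succ_pos _),
    fun i j' => (pow_dvd_iff_le_degree hd.le _).2 (key i j').1,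
    fun i j' hlt => (pow_dvd_iff_le_degree hd _).2 ((key i j').2 hlt)⟩

/-! ### Reduction of a row -/

/-- Pivots are treated from top to bottom. Later rows vanish in the earlier pivot columns, so
entries already reduced stay reduced. -/
theorem exists_isReduced (hR : IsChainRing R π q s) {T : Set R} (hT : IsResidueSystem π T)
    {B : Matrix (Fin n) (Fin m) R} (hB : IsRowCanonical π s T B) (v : Fin m → R) :
    ∃ c : Fin n → R, IsReduced π s T B (v + ∑ i, c i • B i) := by
  induction n generalizing v with
  | zero => exact ⟨0, fun i => i.elim0⟩
  | succ n ih =>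
    by_cases hB0 : B = 0
    · subst hB0
      exact ⟨0, fun i j h => absurd rfl h.1⟩
    obtain ⟨d, j, hj⟩ := hB.exists_isHead hR hB0
    obtain ⟨c0, hc0⟩ := exists_add_mul_mem_residuesPow (π := π) hT d (v j)
    obtain ⟨c, hc⟩ := ih hB.tailRows (v + c0 • B 0)
    refine ⟨Fin.cons c0 c, ?_⟩
    have hsum : v + ∑ i, (Fin.cons c0 c : Fin (n + 1) → R) i • B i =
        v + c0 • B 0 + ∑ i, c i • tailRows B i := by
      simp [Fin.sum_univ_succ, add_assoc]
    rw [hsum]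
    intro i j' hp l hl hpl
    rcases Fin.eq_zero_or_eq_succ i with rfl | ⟨i, rfl⟩
    · obtain rfl := hp.unique (hj.isPivot hR)
      have : l = d := by
        rw [← hR.degree_pow hl, ← hpl, hj.head, hR.degree_pow hj.lt]
      subst this
      have hz : (∑ i, c i • tailRows B i) j' = 0 := by
        rw [Finset.sum_apply]
        exact Finset.sum_eq_zero fun i _ => by
          rw [Pi.smul_apply, hj.below i, smul_zero]
      rw [Pi.add_apply, hz, add_zero, Pi.add_apply, Pi.smul_apply, hj.head, smul_eq_mul]
      exact hc0
    · exact hc i j' hp l hl hpl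

theorem eq_zero_of_isReduced (hR : IsChainRing R π q s) {T : Set R} (hT : IsResidueSystem π T)
    {B : Matrix (Fin n) (Fin m) R} (hB : IsRowCanonical π s T B) {v w : Fin m → R}
    (hv : IsReduced π s T B v) (hvw : IsReduced π s T B (v + w)) (hw : w ∈ rowSpan B) :
    w = 0 := by
  induction n generalizing w with
  | zero =>
    obtain ⟨c, rfl⟩ := mem_rowSpan.1 hw
    simp
  | succ n ih =>
    by_cases hB0 : B = 0
    · subst hB0
      obtain ⟨c, rfl⟩ := mem_rowSpan.1 hw
      exact Finset.sum_eq_zero fun i _ => smul_zero _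
    obtain ⟨d, j, hj⟩ := hB.exists_isHead hR hB0
    obtain ⟨c0, w', hw', rfl⟩ := mem_rowSpan_succ.1 hw
    have hp := hj.isPivot hR
    have hz : w' j = 0 :=
      zero_dvd_iff.1 (dvd_of_mem_rowSpan (fun i => (hj.below i).symm ▸ dvd_rfl) hw')
    have h1 := hv 0 j hp d hj.lt hj.head
    have h2 := hvw 0 j hp d hj.lt hj.head
    simp only [Pi.add_apply, Pi.smul_apply, hz, hj.head, add_zero, smul_eq_mul] at h2
    -- In column `j` both `v` and `v + w` have entries in `T_d` that are congruent modulo `π ^ d`,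
    -- hence equal. As `π ^ d` divides all of row `0`, this kills its whole contribution.
    have h3 : c0 * π ^ d = 0 := by
      have := residuesPow_injective hR hT hj.lt.le h2 h1 ⟨c0, by ring⟩
      simpa using this
    have h4 : c0 • B 0 = 0 := by
      ext j'
      obtain ⟨a, ha⟩ := hj.dvd 0 j'
      rw [Pi.smul_apply, ha, smul_eq_mul, ← mul_assoc, h3, zero_mul, Pi.zero_apply]
    rw [h4, zero_add] at hvw ⊢
    exact ih hB.tailRows (fun i j => hv i.succ j) (fun i j => hvw i.succ j) hw'

/-! ### Uniqueness and existence of the row canonical form -/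

theorem IsHead.dvd_of_mem {A : Matrix (Fin (n + 1)) (Fin m) R} {d : ℕ} {j : Fin m}
    (h : IsHead π s A d j) {v : Fin m → R} (hv : v ∈ rowSpan A) (j') : π ^ d ∣ v j' :=
  dvd_of_mem_rowSpan (fun i => h.dvd i j') hv

/-- A combination that vanishes in column `j` uses row `0` with a coefficient killing `π ^ d`, hence
killing the row. Thus the tail's span depends only on the full span and `j`, as uniqueness requires.
-/
theorem IsHead.mem_rowSpan_tailRows_iff {A : Matrix (Fin (n + 1)) (Fin m) R} {d : ℕ} {j : Fin m}
    (h : IsHead π s A d j) {v : Fin m → R} :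
    v ∈ rowSpan (tailRows A) ↔ v ∈ rowSpan A ∧ v j = 0 := by
  constructor
  · intro hv
    refine ⟨mem_rowSpan_succ.2 ⟨0, v, hv, by simp⟩, ?_⟩
    exact zero_dvd_iff.1 (dvd_of_mem_rowSpan (fun i => (h.below i).symm ▸ dvd_rfl) hv)
  · rintro ⟨hv, hj⟩
    obtain ⟨c, w, hw, rfl⟩ := mem_rowSpan_succ.1 hv
    have hz : w j = 0 :=
      zero_dvd_iff.1 (dvd_of_mem_rowSpan (fun i => (h.below i).symm ▸ dvd_rfl) hw)
    have h3 : c * π ^ d = 0 := by simpa [hz, h.head] using hj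
    have h4 : c • A 0 = 0 := by
      ext j'
      obtain ⟨a, ha⟩ := h.dvd 0 j'
      rw [Pi.smul_apply, ha, smul_eq_mul, ← mul_assoc, h3, zero_mul, Pi.zero_apply]
    rwa [h4, zero_add]

theorem IsHead.le_of_rowSpan_le (hR : IsChainRing R π q s)
    {A B : Matrix (Fin (n + 1)) (Fin m) R} {d d' : ℕ} {j j' : Fin m} (hA : IsHead π s A d j)
    (hB : IsHead π s B d' j') (h : rowSpan A ≤ rowSpan B) : d' ≤ d := by
  have := hB.dvd_of_mem (h (row_mem_rowSpan A 0)) j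
  rwa [hA.head, hR.pow_dvd_pow_iff hA.lt] at this

theorem IsHead.not_lt_of_rowSpan_le (hR : IsChainRing R π q s)
    {A B : Matrix (Fin (n + 1)) (Fin m) R} {d : ℕ} {j j' : Fin m} (hA : IsHead π s A d j)
    (hB : IsHead π s B d j') (h : rowSpan A ≤ rowSpan B) : ¬ j < j' := by
  intro hlt
  have := dvd_of_mem_rowSpan (fun i => hB.dvd_left i j hlt) (h (row_mem_rowSpan A 0))
  rw [hA.head, hR.pow_dvd_pow_iff hA.lt] at this
  omega

theorem eq_zero_of_rowSpan_eq_bot {A : Matrix (Fin n) (Fin m) R} (h : rowSpan A = ⊥) : A = 0 := by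
  funext i
  have := row_mem_rowSpan A i
  rwa [h, Submodule.mem_bot] at this

theorem rowSpan_zero : rowSpan (0 : Matrix (Fin n) (Fin m) R) = ⊥ := by
  refine le_bot_iff.1 (Submodule.span_le.2 ?_)
  rintro _ ⟨i, rfl⟩
  exact rfl

theorem IsRowCanonical.eq_of_rowSpan_eq (hR : IsChainRing R π q s) {T : Set R}
    (hT : IsResidueSystem π T) {A B : Matrix (Fin n) (Fin m) R} (hA : IsRowCanonical π s T A)
    (hB : IsRowCanonical π s T B) (h : rowSpan A = rowSpan B) : A = B := by
  induction n with
  | zero => exact funext fun i => i.elim0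
  | succ n ih =>
    by_cases hA0 : A = 0
    · subst hA0
      exact (eq_zero_of_rowSpan_eq_bot (h.symm.trans rowSpan_zero)).symm
    have hB0 : B ≠ 0 := by
      rintro rfl
      exact hA0 (eq_zero_of_rowSpan_eq_bot (h.trans rowSpan_zero))
    obtain ⟨d, j, hAj⟩ := hA.exists_isHead hR hA0
    obtain ⟨d', j', hBj⟩ := hB.exists_isHead hR hB0
    obtain rfl := le_antisymm (hBj.le_of_rowSpan_le hR hAj h.ge) (hAj.le_of_rowSpan_le hR hBj h.le)
    obtain rfl : j = j' := le_antisymm (not_lt.1 (hBj.not_lt_of_rowSpan_le hR hAj h.ge))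
      (not_lt.1 (hAj.not_lt_of_rowSpan_le hR hBj h.le))
    have htail : ChainRing.tailRows A = ChainRing.tailRows B := by
      refine ih hA.tailRows hB.tailRows (Submodule.ext fun v => ?_)
      rw [hAj.mem_rowSpan_tailRows_iff, hBj.mem_rowSpan_tailRows_iff, h]
    have hmem : A 0 - B 0 ∈ rowSpan (ChainRing.tailRows B) := by
      rw [hBj.mem_rowSpan_tailRows_iff]
      refine ⟨sub_mem (h ▸ row_mem_rowSpan A 0) (row_mem_rowSpan B 0), ?_⟩
      rw [Pi.sub_apply, hAj.head, hBj.head, sub_self]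
    -- The first rows agree at the pivot, so their difference lies in the span of the common tail;
    -- both being reduced modulo that tail, they coincide.
    have hzero := eq_zero_of_isReduced hR hT hB.tailRows hB.isReduced
      (w := A 0 - B 0) (by rw [add_sub_cancel, ← htail]; exact hA.isReduced) hmem
    funext i
    rcases Fin.eq_zero_or_eq_succ i with rfl | ⟨i, rfl⟩
    · exact sub_eq_zero.1 hzero
    · exact congrFun htail i

theorem exists_rowEquiv_isHead (hR : IsChainRing R π q s) {A : Matrix (Fin (n + 1)) (Fin m) R}
    (hA : A ≠ 0) : ∃ B d j, RowEquiv A B ∧ IsHead π s B d j := by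
  classical
  obtain ⟨i0, hi0⟩ := Function.ne_iff.1 hA
  obtain ⟨j0, hj0⟩ := Function.ne_iff.1 hi0
  obtain ⟨⟨i1, j1⟩, -, hmin⟩ := Finset.exists_min_image Finset.univ
    (fun p : Fin (n + 1) × Fin m => degree π s (A p.1 p.2)) ⟨(i0, j0), Finset.mem_univ _⟩
  set d := degree π s (A i1 j1) with hd
  have hds : d < s := (hmin (i0, j0) (Finset.mem_univ _)).trans_lt (hR.degree_lt_iff.2 hj0)
  -- Among the entries of least degree `d` in the whole matrix, one in the leftmost possible column
  -- is taken.
  let S := Finset.univ.filter fun j => ∃ i, degree π s (A i j) = d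
  have hS : S.Nonempty := ⟨j1, by simpa [S] using ⟨i1, rfl⟩⟩
  have hjS := Finset.min'_mem S hS
  set j := S.min' hS with hj
  obtain ⟨i, hi⟩ : ∃ i, degree π s (A i j) = d := by simpa [S] using hjS
  have hdvd : ∀ i j', π ^ d ∣ A i j' := fun i j' =>
    (pow_dvd_iff_le_degree hds.le _).2 (hmin (i, j') (Finset.mem_univ _))
  have hleft : ∀ i, ∀ j' < j, π ^ (d + 1) ∣ A i j' := by
    intro i j' hlt
    refine (pow_dvd_iff_le_degree hds _).2 ?_
    refine lt_of_le_of_ne (hmin (i, j') (Finset.mem_univ _)) fun heq => ?_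
    exact absurd (S.min'_le j' (by simpa [S] using ⟨i, heq.symm⟩)) (not_le.2 hlt)
  obtain ⟨u, hu⟩ := hR.exists_unit_mul_pow (A i j)
  rw [hi] at hu
  let A' := A.submatrix (Equiv.swap 0 i) id
  have hA' : A' 0 = A i := by
    funext j'
    simp [A']
  choose a ha using fun k : Fin n => hdvd (Equiv.swap 0 i k.succ) j
  -- The chosen row is swapped to the top. Its entry is `u * π ^ d` and the one below is `π ^ d * a
  -- k`, which determines the multiplier `-a k * u⁻¹`.
  refine ⟨_, d, j, (rowEquiv_permute (Equiv.swap 0 i) A).trans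
    (rowEquiv_clear u⁻¹ (fun k => -a k * ((u⁻¹ : Rˣ) : R)) A'), hds, ?_, ?_, ?_, ?_⟩
  · rw [consRow_zero, hA', Pi.smul_apply, hu, smul_eq_mul, Units.inv_mul_cancel_left]
  · intro k
    have : A' k.succ j = π ^ d * a k := ha k
    simp only [tailRows_apply, consRow_succ, Matrix.of_apply, Pi.add_apply, Pi.smul_apply, hA', hu,
      smul_eq_mul, this]
    have := u.inv_mul
    linear_combination (-a k * π ^ d) * this
  · intro k j'
    rcases Fin.eq_zero_or_eq_succ k with rfl | ⟨k, rfl⟩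
    · rw [consRow_zero, hA']
      exact Dvd.dvd.mul_left (hdvd i j') _
    · rw [consRow_succ, hA']
      exact dvd_add (hdvd _ j') (Dvd.dvd.mul_left (hdvd i j') _)
  · intro k j' hlt
    rcases Fin.eq_zero_or_eq_succ k with rfl | ⟨k, rfl⟩
    · rw [consRow_zero, hA']
      exact Dvd.dvd.mul_left (hleft i j' hlt) _
    · rw [consRow_succ, hA']
      exact dvd_add (hleft _ j' hlt) (Dvd.dvd.mul_left (hleft i j' hlt) _)

theorem exists_rowEquiv_isRowCanonical (hR : IsChainRing R π q s) {T : Set R}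
    (hT : IsResidueSystem π T) (A : Matrix (Fin n) (Fin m) R) :
    ∃ B, RowEquiv A B ∧ IsRowCanonical π s T B := by
  induction n with
  | zero =>
    have : A = 0 := funext fun i => i.elim0
    exact ⟨A, .refl A, this ▸ isRowCanonical_zero T⟩
  | succ n ih =>
    by_cases hA0 : A = 0
    · exact ⟨A, .refl A, hA0 ▸ isRowCanonical_zero T⟩
    obtain ⟨A1, d, j, h1, hj⟩ := exists_rowEquiv_isHead hR hA0
    obtain ⟨B, hAB, hB⟩ := ih (tailRows A1)
    have h2 : RowEquiv A1 (consRow (A1 0) B) := by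
      have := rowEquiv_consRow hAB (A1 0)
      rwa [show consRow (A1 0) (tailRows A1) = A1 from
        funext fun i => by refine Fin.cases rfl (fun i => rfl) i] at this
    obtain ⟨c, hc⟩ := exists_isReduced hR hT hB (A1 0)
    have h3 := rowEquiv_reduce c (consRow (A1 0) B)
    -- Rows of `B` are combinations of rows of `A1`, so column-wise divisibilities, and with them
    -- the head conditions, survive.
    have hrow : ∀ {a : R} {j' : Fin m}, (∀ i, a ∣ A1 i j') → ∀ i, a ∣ B i j' := fun h i =>
      dvd_of_mem_rowSpan (fun i => h i.succ) (hAB.rowSpan_eq ▸ row_mem_rowSpan B i)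
    have hrow' : ∀ {a : R} {j' : Fin m}, (∀ i, a ∣ A1 i j') →
        a ∣ (A1 0 + ∑ i, c i • B i) j' := fun h => by
      rw [Pi.add_apply, Finset.sum_apply]
      exact dvd_add (h 0) (Finset.dvd_sum fun i _ => Dvd.dvd.mul_left (hrow h i) _)
    have hz : ∀ i, B i j = 0 := fun i => zero_dvd_iff.1
      (dvd_of_mem_rowSpan (fun i => (hj.below i).symm ▸ dvd_rfl)
        (hAB.rowSpan_eq ▸ row_mem_rowSpan B i))
    refine ⟨_, h1.trans (h2.trans h3), IsHead.isRowCanonical hR (d := d) (j := j)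
      ⟨hj.lt, ?_, ?_, ?_, ?_⟩ hB hc⟩
    · change (A1 0 + ∑ i, c i • B i) j = _
      rw [Pi.add_apply, Finset.sum_apply, hj.head]
      simp [hz]
    · exact hz
    · intro i j'
      rcases Fin.eq_zero_or_eq_succ i with rfl | ⟨i, rfl⟩
      · exact hrow' fun i => hj.dvd i j'
      · exact hrow (fun i => hj.dvd i j') i
    · intro i j' hlt
      rcases Fin.eq_zero_or_eq_succ i with rfl | ⟨i, rfl⟩
      · exact hrow' fun i => hj.dvd_left i j' hlt
      · exact hrow (fun i => hj.dvd_left i j' hlt) i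

/-- Both matrices are row equivalent to the same canonical form. -/
theorem rowEquiv_of_rowSpan_eq (hR : IsChainRing R π q s) {T : Set R} (hT : IsResidueSystem π T)
    {A B : Matrix (Fin n) (Fin m) R} (h : rowSpan A = rowSpan B) : RowEquiv A B := by
  obtain ⟨A', hA, hA'⟩ := exists_rowEquiv_isRowCanonical hR hT A
  obtain ⟨B', hB, hB'⟩ := exists_rowEquiv_isRowCanonical hR hT B
  obtain rfl := hA'.eq_of_rowSpan_eq hR hT hB' (by rw [← hA.rowSpan_eq, ← hB.rowSpan_eq, h])
  exact hA.trans hB.symm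

end RowCanonical

/-! ### Channels that reveal exactly a class of the input. -/

section Channel

variable {α β γ : Type*} [Fintype α] [Fintype β]

/-- Output `y` of the channel `W` determines the class `g y = f x` of the input `x`, and the
transition probabilities depend on this class only. -/
structure IsClassChannel (W : α → β → ℝ) (f : α → γ) (g : β → γ) : Prop where
  nonneg : ∀ x y, 0 ≤ W x y
  sum_eq_one : ∀ x, ∑ y, W x y = 1
  class_eq : ∀ x y, W x y ≠ 0 → g y = f x
  congr : ∀ x x', f x = f x' → W x = W x'

open Classical in
/-- The probability of the class `c` under the input distribution `p`. -/
noncomputable def classProb (f : α → γ) (p : α → ℝ) (c : γ) : ℝ := ∑ x, if f x = c then p x else 0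

theorem classProb_nonneg {f : α → γ} {p : α → ℝ} (hp : ∀ x, 0 ≤ p x) (c : γ) :
    0 ≤ classProb f p c :=
  Finset.sum_nonneg fun x _ => by split_ifs <;> simp [hp]

open Classical in
theorem sum_mul_classProb (f : α → γ) (p : α → ℝ) (F : γ → ℝ) :
    ∑ x, p x * F (f x) = ∑ c ∈ Finset.univ.image f, classProb f p c * F c := by
  rw [← Finset.sum_fiberwise_of_maps_to (g := f) (t := Finset.univ.image f)
    fun x hx => Finset.mem_image_of_mem f hx]
  refine Finset.sum_congr rfl fun c _ => ?_
  rw [classProb, Finset.sum_mul, Finset.sum_filter]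
  refine Finset.sum_congr rfl fun x _ => ?_
  split_ifs with h
  · rw [h]
  · rw [zero_mul]

variable {W : α → β → ℝ} {f : α → γ} {g : β → γ} {b : ℝ}

open Classical in
theorem IsClassChannel.mutualInfo_eq (h : IsClassChannel W f g) (p : α → ℝ) :
    mutualInfo b p W =
      ∑ c ∈ Finset.univ.image f, classProb f p c * Real.logb b (classProb f p c)⁻¹ := by
  rw [← sum_mul_classProb f p fun c => Real.logb b (classProb f p c)⁻¹, mutualInfo]
  refine Finset.sum_congr rfl fun x _ => ?_
  calc ∑ y, p x * W x y * Real.logb b (W x y / ∑ x', p x' * W x' y)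
      = ∑ y, W x y * (p x * Real.logb b (classProb f p (f x))⁻¹) := by
        refine Finset.sum_congr rfl fun y _ => ?_
        by_cases hW : W x y = 0
        · simp [hW]
        -- Only inputs in the class of `x` can produce `y`, all with probability `W x y`. The
        -- likelihood ratio is therefore the inverse class probability.
        have hsum : ∑ x', p x' * W x' y = classProb f p (f x) * W x y := by
          rw [classProb, Finset.sum_mul]
          refine Finset.sum_congr rfl fun x' _ => ?_
          split_ifs with hx
          · rw [h.congr x' x hx]
          · by_cases hW' : W x' y = 0
            · rw [hW']; simp
            · exact absurd ((h.class_eq x' y hW').symm.trans (h.class_eq x y hW)) hx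
        rw [hsum, div_mul_cancel_right₀ hW]
        ring
    _ = p x * Real.logb b (classProb f p (f x))⁻¹ := by
        rw [← Finset.sum_mul, h.sum_eq_one, one_mul]

open Classical in
theorem IsClassChannel.mutualInfo_le (h : IsClassChannel W f g) (hb : 1 < b) {p : α → ℝ}
    (hp : p ∈ stdSimplex ℝ α) :
    mutualInfo b p W ≤ Real.logb b ((Set.range f).ncard : ℝ) := by
  have hcard : (Set.range f).ncard = (Finset.univ.image f).card := by
    rw [← Set.ncard_coe_finset, Finset.coe_image, Finset.coe_univ, Set.image_univ]
  have hsum : ∑ c ∈ Finset.univ.image f, classProb f p c = 1 := by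
    have := sum_mul_classProb f p fun _ => 1
    simpa [hp.2] using this.symm
  set S := Finset.univ.image f
  have hS : (0 : ℝ) < S.card := by
    rw [Nat.cast_pos, Finset.card_pos, Finset.nonempty_iff_ne_empty]
    intro h0
    simp [h0] at hsum
  have hlog : 0 < Real.log b := Real.log_pos hb
  rw [h.mutualInfo_eq, hcard, Real.logb, le_div_iff₀ hlog, Finset.sum_mul]
  -- Gibbs' inequality: `log t ≤ t - 1` at `t = 1 / (P |S|)`, multiplied by `P`. The correction
  -- terms sum to zero. A class with `P = 0` contributes nothing on the left.
  have key : ∀ c ∈ S, classProb f p c * Real.logb b (classProb f p c)⁻¹ * Real.log b ≤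
      classProb f p c * Real.log S.card + ((S.card : ℝ)⁻¹ - classProb f p c) := by
    intro c _
    rw [mul_assoc, Real.logb, div_mul_cancel₀ _ hlog.ne']
    rcases (classProb_nonneg (f := f) hp.1 c).eq_or_lt with h0 | h0
    · rw [← h0]
      simp
    · set P := classProb f p c
      have h1 : Real.log (P * S.card)⁻¹ ≤ (P * S.card)⁻¹ - 1 :=
        Real.log_le_sub_one_of_pos (by positivity)
      have h2 : Real.log (P * S.card)⁻¹ = Real.log P⁻¹ - Real.log S.card := by
        rw [Real.log_inv, Real.log_mul h0.ne' hS.ne', Real.log_inv]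
        ring
      have h3 : P * (P * S.card)⁻¹ = (S.card : ℝ)⁻¹ := by
        field_simp
      nlinarith [mul_le_mul_of_nonneg_left h1 h0.le]
  refine (Finset.sum_le_sum key).trans_eq ?_
  rw [Finset.sum_add_distrib, ← Finset.sum_mul, Finset.sum_sub_distrib, hsum, Finset.sum_const,
    nsmul_eq_mul, mul_inv_cancel₀ hS.ne']
  ring

theorem uniformOn_mem_stdSimplex {S : Set α} (hS : S.Nonempty) :
    uniformOn S ∈ stdSimplex ℝ α := by
  classical
  have hcard : (S.ncard : ℝ) ≠ 0 := by
    rw [Nat.cast_ne_zero]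
    exact (Set.ncard_pos (Set.toFinite S)).2 hS |>.ne'
  refine ⟨fun x => Set.indicator_nonneg (fun _ _ => by positivity) x, ?_⟩
  rw [uniformOn, Finset.sum_indicator_eq_sum_filter, Finset.sum_const, nsmul_eq_mul]
  have : (Finset.univ.filter fun x => x ∈ S).card = S.ncard := by
    rw [← Set.ncard_coe_finset]
    congr 1
    ext; simp
  rw [this, mul_inv_cancel₀ hcard]

open Classical in
theorem IsClassChannel.mutualInfo_uniformOn (h : IsClassChannel W f g) {S : Set α}
    (hS : Set.BijOn f S (Set.range f)) (hne : S.Nonempty) :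
    mutualInfo b (uniformOn S) W = Real.logb b ((Set.range f).ncard : ℝ) := by
  have hcard : S.ncard = (Set.range f).ncard := by
    rw [← hS.image_eq, hS.injOn.ncard_image]
  have hcard' : (Set.range f).ncard = (Finset.univ.image f).card := by
    rw [← Set.ncard_coe_finset, Finset.coe_image, Finset.coe_univ, Set.image_univ]
  have hpos : ((Set.range f).ncard : ℝ) ≠ 0 := by
    rw [← hcard, Nat.cast_ne_zero]
    exact (Set.ncard_pos (Set.toFinite S)).2 hne |>.ne'
  have hP : ∀ c ∈ Finset.univ.image f, classProb f (uniformOn S) c =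
      ((Set.range f).ncard : ℝ)⁻¹ := by
    intro c hc
    obtain ⟨x0, -, rfl⟩ := Finset.mem_image.1 hc
    obtain ⟨x, hx, hxc⟩ := hS.surjOn ⟨x0, rfl⟩
    rw [classProb, Finset.sum_eq_single x]
    · rw [if_pos hxc, uniformOn, Set.indicator_of_mem hx, hcard]
    · intro x' _ hx'
      split_ifs with h1
      · refine Set.indicator_of_notMem (fun h2 => hx' ?_) _
        exact hS.injOn h2 hx (h1.trans hxc.symm)
      · rfl
    · exact fun h => absurd (Finset.mem_univ x) h
  rw [h.mutualInfo_eq, Finset.sum_congr rfl fun c hc => by rw [hP c hc], Finset.sum_const,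
    nsmul_eq_mul, ← hcard', inv_inv, ← mul_assoc, mul_inv_cancel₀ hpos, one_mul]

theorem IsClassChannel.isCapacity (h : IsClassChannel W f g) (hb : 1 < b) {S : Set α}
    (hS : Set.BijOn f S (Set.range f)) (hne : S.Nonempty) :
    IsCapacity b W (Real.logb b ((Set.range f).ncard : ℝ)) := by
  refine ⟨⟨_, uniformOn_mem_stdSimplex hne, h.mutualInfo_uniformOn hS hne⟩, ?_⟩
  rintro _ ⟨p, hp, rfl⟩
  exact h.mutualInfo_le hb hp

theorem IsClassChannel.exists_decoder (h : IsClassChannel W f g) {S : Set α}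
    (hS : Set.InjOn f S) (hne : S.Nonempty) :
    ∃ D : β → α, ∀ x ∈ S, errorProb W D x = 0 := by
  classical
  obtain ⟨x0, -⟩ := hne
  -- The default `x0` is harmless: an output whose class contains no codeword has probability zero
  -- for every codeword.
  refine ⟨fun y => if hy : ∃ x ∈ S, f x = g y then hy.choose else x0, fun x hx => ?_⟩
  refine Finset.sum_eq_zero fun y _ => ?_
  by_cases hW : W x y = 0
  · simp [hW]
  have hy : ∃ x ∈ S, f x = g y := ⟨x, hx, (h.class_eq x y hW).symm⟩
  have := hS hy.choose_spec.1 hx (hy.choose_spec.2.trans (h.class_eq x y hW))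
  exact if_pos ((dif_pos hy).trans this)

end Channel

/-! ### Matrices of full column rank -/

section FullColumnRank

variable {R : Type*} [CommRing R] {π : R} {q s : ℕ}

/-- Positivity of `s` matters: for `s = 0` the supremum is empty and equals `0`. -/
theorem packetLength_const (hs : 0 < s) (n : ℕ) : packetLength (fun _ : Fin s => n) = n := by
  have : Nonempty (Fin s) := ⟨⟨0, hs⟩⟩
  exact Finset.sup_const Finset.univ_nonempty n

theorem shapeModule_const (hs : 0 < s) (n : ℕ) :
    shapeModule π (fun _ : Fin s => n) = (⊤ : Submodule R _) := by
  refine eq_top_iff.2 fun v _ => ?_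
  rw [shapeModule, Submodule.mem_pi]
  intro j _
  have hj : ¬ n ≤ (j : ℕ) := by
    have := j.2
    have h2 := packetLength_const hs n
    omega
  have : shapeExponent (fun _ : Fin s => n) (j : ℕ) = 0 := by
    simp [shapeExponent, hj]
  rw [this, pow_zero, Ideal.span_singleton_one]
  trivial

/-- The free module of rank `n` is the module of constant shape `n`. -/
noncomputable def shapeModuleConstEquiv (π : R) (hs : 0 < s) (n : ℕ) :
    shapeModule π (fun _ : Fin s => n) ≃ₗ[R] (Fin n → R) :=
  (LinearEquiv.ofTop _ (shapeModule_const hs n)).trans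
    (LinearEquiv.funCongrLeft R R (finCongr (packetLength_const hs n).symm))

theorem rowSpan_transpose_eq_range {N n : ℕ} (A : Matrix (Fin N) (Fin n) R) :
    rowSpan A.transpose = LinearMap.range A.mulVecLin := by
  rw [Matrix.range_mulVecLin]
  rfl

theorem isFullColumnRank_of_leftInverse (hs : 0 < s) {N n : ℕ} {A : Matrix (Fin N) (Fin n) R}
    {B : Matrix (Fin n) (Fin N) R} (h : B * A = 1) : IsFullColumnRank π s A := by
  have hinj : Function.Injective A.mulVecLin := by
    refine Function.LeftInverse.injective (g := B.mulVecLin) fun v => ?_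
    simp [h]
  rw [IsFullColumnRank, HasShape, rowSpan_transpose_eq_range]
  exact ⟨(LinearEquiv.ofInjective _ hinj).symm.trans (shapeModuleConstEquiv π hs n).symm⟩

/-- Composed with the isomorphism from its image to `R^n`, `A` becomes a surjective self-map of a
finite set. -/
theorem IsFullColumnRank.mulVec_injective [Finite R] (hs : 0 < s) {N n : ℕ}
    {A : Matrix (Fin N) (Fin n) R} (h : IsFullColumnRank π s A) :
    Function.Injective A.mulVec := by
  rw [IsFullColumnRank, HasShape, rowSpan_transpose_eq_range] at h
  obtain ⟨e⟩ := h
  let e' := e.trans (shapeModuleConstEquiv π hs n)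
  have hsurj : Function.Surjective (fun v => e' (A.mulVecLin.rangeRestrict v)) :=
    e'.surjective.comp A.mulVecLin.surjective_rangeRestrict
  have hinj := Finite.injective_iff_surjective.2 hsurj
  intro v w hvw
  refine hinj ?_
  have : A.mulVecLin.rangeRestrict v = A.mulVecLin.rangeRestrict w := Subtype.ext hvw
  simp only [this]

theorem IsFullColumnRank.exists_leftInverse [Finite R] (hR : IsChainRing R π q s) {N n : ℕ}
    {A : Matrix (Fin N) (Fin n) R} (h : IsFullColumnRank π s A) :
    ∃ B : Matrix (Fin n) (Fin N) R, B * A = 1 := by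
  have hinj := h.mulVec_injective hR.pos
  have := hR.isMaximal
  let _ : Field (R ⧸ Ideal.span {π}) := Ideal.Quotient.field _
  let φ := Ideal.Quotient.mk (Ideal.span {π})
  have hφ : Function.Surjective φ := Ideal.Quotient.mk_surjective
  have hker : ∀ a, φ a = 0 ↔ π ∣ a := fun a => by
    rw [Ideal.Quotient.eq_zero_iff_mem, Ideal.mem_span_singleton]
  have hs := hR.pos
  -- Injectivity descends to the residue field: if `A w` vanishes modulo `π`, then `A (π ^ (s - 1)
  -- w) = 0`, so `π ^ (s - 1) w = 0` and `π` divides `w`.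
  have hinj' : Function.Injective (A.map φ).mulVecLin := by
    rw [← LinearMap.ker_eq_bot, LinearMap.ker_eq_bot']
    intro v hv
    choose w hw using fun i => hφ (v i)
    have h1 : A.mulVec (π ^ (s - 1) • w) = A.mulVec 0 := by
      rw [Matrix.mulVec_smul, Matrix.mulVec_zero]
      ext i
      have h2 : φ (A.mulVec w i) = 0 := by
        have := congrFun hv i
        simpa [Matrix.mulVec, dotProduct, ← hw] using this
      obtain ⟨c, hc⟩ := (hker _).1 h2
      rw [Pi.smul_apply, hc, smul_eq_mul, ← mul_assoc, ← pow_succ, Nat.sub_add_cancel hs,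
        hR.pow_eq_zero, zero_mul, Pi.zero_apply]
    have h3 := hinj h1
    ext i
    rw [← hw, Pi.zero_apply, hker]
    have := hR.dvd_of_pow_mul_eq_zero (congrFun h3 i)
    rwa [Nat.sub_sub_self hs, pow_one] at this
  obtain ⟨g, hg⟩ := LinearMap.exists_leftInverse_of_injective _ (LinearMap.ker_eq_bot.2 hinj')
  choose B0 hB0 using fun i j => hφ (LinearMap.toMatrix' g i j)
  have hBA : (Matrix.of B0 * A).map φ = 1 := by
    have h1 : (Matrix.of B0).map φ = LinearMap.toMatrix' g := by
      ext i j; simp [hB0]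
    have h2 : A.map φ = LinearMap.toMatrix' (A.map φ).mulVecLin := by
      rw [← Matrix.toLin'_apply', LinearMap.toMatrix'_toLin']
    rw [Matrix.map_mul, h1, h2, ← LinearMap.toMatrix'_comp, hg, LinearMap.toMatrix'_id]
  -- A lift `B0` of the left inverse over the residue field makes `B0 * A` the identity modulo `π`,
  -- hence invertible over `R`.
  have hdet : IsUnit (Matrix.of B0 * A).det := by
    refine hR.isUnit_of_not_dvd fun hd => ?_
    rw [← hker, RingHom.map_det] at hd
    change (Matrix.map (Matrix.of B0 * A) φ).det = 0 at hd
    rw [hBA, Matrix.det_one] at hd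
    exact one_ne_zero hd
  exact ⟨(Matrix.of B0 * A)⁻¹ * Matrix.of B0, by
    rw [Matrix.mul_assoc, Matrix.nonsing_inv_mul _ hdet]⟩

theorem exists_isFullColumnRank (hs : 0 < s) {N n : ℕ} (hnN : n ≤ N) :
    ∃ A : Matrix (Fin N) (Fin n) R, IsFullColumnRank π s A := by
  refine ⟨(1 : Matrix (Fin N) (Fin N) R).submatrix id (Fin.castLE hnN),
    isFullColumnRank_of_leftInverse hs
      (B := (1 : Matrix (Fin N) (Fin N) R).submatrix (Fin.castLE hnN) id) ?_⟩
  ext i j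
  simp [Matrix.mul_apply, Matrix.one_apply]

theorem isFullColumnRank_mul_iff {N n : ℕ} {A : Matrix (Fin N) (Fin n) R}
    {U V : Matrix (Fin n) (Fin n) R} (h : U * V = 1) :
    IsFullColumnRank π s (A * U) ↔ IsFullColumnRank π s A := by
  have h2 : V.transpose * U.transpose = 1 := by
    rw [← Matrix.transpose_mul, h, Matrix.transpose_one]
  have : rowSpan (A * U).transpose = rowSpan A.transpose := by
    rw [Matrix.transpose_mul]
    exact rowSpan_mul_of_leftInverse h2 _
  rw [IsFullColumnRank, IsFullColumnRank, this]

end FullColumnRank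

/-! ### The multiplicative matrix channel -/

section MMC

variable {R : Type*} [CommRing R] {π : R} {q s : ℕ}

theorem forall_row_mem_iff {n m : ℕ} {A : Matrix (Fin n) (Fin m) R}
    {M : Submodule R (Fin m → R)} : (∀ i, A i ∈ M) ↔ rowSpan A ≤ M := by
  rw [rowSpan, Submodule.span_le, Set.range_subset_iff]
  rfl

theorem bijOn_rowCanonicalCode (hR : IsChainRing R π q s) {T : Set R} (hT : IsResidueSystem π T)
    (n : ℕ) (μ : Fin s → ℕ) :
    Set.BijOn (fun X : ShapeMatrix π n μ => rowSpan X.1) (rowCanonicalCode π T n μ)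
      (Set.range fun X : ShapeMatrix π n μ => rowSpan X.1) := by
  refine ⟨fun X _ => ⟨X, rfl⟩, fun X hX Y hY h => ?_, ?_⟩
  · exact Subtype.ext (IsRowCanonical.eq_of_rowSpan_eq hR hT hX hY h)
  · rintro _ ⟨X, rfl⟩
    obtain ⟨B, hB, hB'⟩ := exists_rowEquiv_isRowCanonical hR hT X.1
    exact ⟨⟨B, forall_row_mem_iff.2 (hB.rowSpan_eq ▸ forall_row_mem_iff.1 X.2)⟩, hB',
      hB.rowSpan_eq.symm⟩

theorem rowCanonicalCode_nonempty (T : Set R) (n : ℕ) (μ : Fin s → ℕ) :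
    (rowCanonicalCode π T n μ).Nonempty :=
  ⟨⟨0, fun _ => Submodule.zero_mem _⟩, isRowCanonical_zero T⟩

theorem isClassChannel_mmc [Finite R] (hR : IsChainRing R π q s) {T : Set R}
    (hT : IsResidueSystem π T) {n N : ℕ} (hnN : n ≤ N) (μ : Fin s → ℕ) :
    IsClassChannel (mmc π N n μ) (fun X => rowSpan X.1) (fun Y => rowSpan Y.1) where
  nonneg X Y := by unfold mmc; positivity
  sum_eq_one X := by
    classical
    -- Here `n ≤ N` enters: it makes the normalising denominator nonzero.
    have hpos : (Nat.card {A : Matrix (Fin N) (Fin n) R // IsFullColumnRank π s A} : ℝ) ≠ 0 := by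
      obtain ⟨A, hA⟩ := exists_isFullColumnRank (R := R) (π := π) hR.pos hnN
      have : Nonempty {A : Matrix (Fin N) (Fin n) R // IsFullColumnRank π s A} := ⟨⟨A, hA⟩⟩
      exact Nat.cast_ne_zero.2 Nat.card_pos.ne'
    simp only [mmc]
    rw [← Finset.sum_div, div_eq_one_iff_eq hpos, ← Nat.cast_sum, ← Nat.card_sigma, Nat.cast_inj]
    refine Nat.card_congr ⟨fun a => ⟨a.2.1, a.2.2.1⟩, fun A => ⟨⟨A.1 * X.1,
      forall_row_mem_iff.2 ((rowSpan_mul_le _ _).trans (forall_row_mem_iff.1 X.2))⟩,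
      A.1, A.2, rfl⟩, ?_, fun A => rfl⟩
    rintro ⟨⟨Y, hY⟩, A, hA, h⟩
    obtain rfl : A * X.1 = Y := h
    rfl
  class_eq X Y h := by
    by_cases he : IsEmpty {A : Matrix (Fin N) (Fin n) R // IsFullColumnRank π s A ∧ A * X.1 = Y.1}
    · exact absurd (by simp [mmc, Nat.card_of_isEmpty]) h
    obtain ⟨A, hA, hAX⟩ := not_isEmpty_iff.1 he
    obtain ⟨B, hB⟩ := hA.exists_leftInverse hR
    rw [← hAX]
    exact rowSpan_mul_of_leftInverse hB _
  congr X X' h := by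
    obtain ⟨U, V, hUV, hVU, hX⟩ := rowEquiv_of_rowSpan_eq hR hT h
    funext Y
    simp only [mmc]
    congr 2
    -- Since `X' = U X` and `V U = 1`, the map `A ↦ A V` carries the solutions of `A X = Y` to those
    -- of `A X' = Y`.
    refine Nat.card_congr ⟨fun A => ⟨A.1 * V, (isFullColumnRank_mul_iff hVU).2 A.2.1, ?_⟩,
      fun A => ⟨A.1 * U, (isFullColumnRank_mul_iff hUV).2 A.2.1, ?_⟩, fun A => ?_, fun A => ?_⟩
    · rw [hX, Matrix.mul_assoc, ← Matrix.mul_assoc V, hVU, Matrix.one_mul, A.2.2]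
    · rw [Matrix.mul_assoc, ← hX, A.2.2]
    · exact Subtype.ext (by simp [Matrix.mul_assoc, hVU])
    · exact Subtype.ext (by simp [Matrix.mul_assoc, hUV])

end MMC

/-! ### Counting subspaces -/

section Gauss

variable {K V : Type*} [Field K] [Finite K] [AddCommGroup V] [Module K V] [Finite V]

/-- A linearly independent `k`-tuple is a `k`-dimensional subspace together with a linearly
independent `k`-tuple in it. -/
noncomputable def linearIndependentEquivSigma (K V : Type*) [Field K] [AddCommGroup V] [Module K V]
    [Finite V] (k : ℕ) :
    {v : Fin k → V // LinearIndependent K v} ≃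
      Σ S : {S : Submodule K V // Module.finrank K S = k},
        {v : Fin k → S.1 // LinearIndependent K v} where
  toFun v := ⟨⟨Submodule.span K (Set.range v.1), by simpa using finrank_span_eq_card v.2⟩,
    fun i => ⟨v.1 i, Submodule.subset_span ⟨i, rfl⟩⟩, linearIndependent_span v.2⟩
  invFun x := ⟨fun i => (x.2.1 i : V), x.2.2.map' x.1.1.subtype (Submodule.ker_subtype _)⟩
  left_inv v := rfl
  right_inv := by
    rintro ⟨⟨S, hS⟩, v, hv⟩
    obtain ⟨v', hmem, rfl⟩ : ∃ v' : Fin k → V, ∃ h : ∀ i, v' i ∈ S, v = fun i => ⟨v' i, h i⟩ :=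
      ⟨fun i => v i, fun i => (v i).2, rfl⟩
    have hv' : LinearIndependent K v' := hv.map' S.subtype (Submodule.ker_subtype _)
    have hS' : Submodule.span K (Set.range v') = S := by
      refine Submodule.eq_of_le_of_finrank_eq (Submodule.span_le.2 ?_) ?_
      · rintro _ ⟨i, rfl⟩
        exact hmem i
      · rw [hS]
        simpa using finrank_span_eq_card hv'
    subst hS'
    rfl

/-- Linearly independent `k`-tuples are counted in `V` directly and again by the subspace they span.
-/
theorem natCard_subspaces_finrank {k : ℕ} (hk : k ≤ Module.finrank K V) :
    (Nat.card {S : Submodule K V // Module.finrank K S = k} : ℝ) =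
      gauss (Nat.card K) (Module.finrank K V) k := by
  classical
  have : Fintype K := Fintype.ofFinite K
  have : Finite (Submodule K V) := Finite.of_injective _ SetLike.coe_injective
  have : Fintype {S : Submodule K V // Module.finrank K S = k} := Fintype.ofFinite _
  have hq : 1 < (Fintype.card K : ℝ) := by exact_mod_cast Fintype.one_lt_card
  have hcast : ∀ m, k ≤ m →
      ((∏ i : Fin k, (Fintype.card K ^ m - Fintype.card K ^ (i : ℕ)) : ℕ) : ℝ) =
      ∏ i ∈ Finset.range k, ((Fintype.card K : ℝ) ^ m - (Fintype.card K : ℝ) ^ i) := by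
    intro m hm
    rw [Finset.prod_range, Nat.cast_prod]
    refine Finset.prod_congr rfl fun i _ => ?_
    rw [Nat.cast_sub (Nat.pow_le_pow_right Fintype.card_pos (i.2.le.trans hm)), Nat.cast_pow,
      Nat.cast_pow]
  have h1 := Nat.card_congr (linearIndependentEquivSigma K V k)
  have h2 : ∀ S : {S : Submodule K V // Module.finrank K S = k},
      Nat.card {v : Fin k → S.1 // LinearIndependent K v} =
        ∏ i : Fin k, (Fintype.card K ^ k - Fintype.card K ^ (i : ℕ)) := fun S => by
    rw [card_linearIndependent S.2.ge, S.2]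
  rw [card_linearIndependent hk, Nat.card_sigma, Finset.sum_congr rfl fun S _ => h2 S,
    Finset.sum_const, Finset.card_univ, smul_eq_mul,
    ← Nat.card_eq_fintype_card (α := {S : Submodule K V // Module.finrank K S = k})] at h1
  have h3 := congrArg (Nat.cast : ℕ → ℝ) h1
  rw [Nat.cast_mul, hcast _ hk, hcast _ le_rfl] at h3
  rw [gauss, Finset.prod_div_distrib, Nat.card_eq_fintype_card (α := K), eq_div_iff, h3]
  refine Finset.prod_ne_zero_iff.2 fun i hi => sub_ne_zero.2 fun h => ?_
  exact (Finset.mem_range.1 hi).ne' (pow_right_injective₀ (by linarith) hq.ne' h)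

theorem natCard_subspaces {q d k : ℕ} (hq : Nat.card K = q) (hd : Nat.card V = q ^ d)
    (hk : k ≤ d) : (Nat.card {S : Submodule K V // Nat.card S = q ^ k} : ℝ) = gauss q d k := by
  have hq1 : 1 < q := hq ▸ Finite.one_lt_card
  have hd' : Module.finrank K V = d := by
    apply Nat.pow_right_injective hq1
    simp only
    rw [← hd, Module.natCard_eq_pow_finrank (K := K) (V := V), hq]
  subst hd'
  rw [← hq, ← natCard_subspaces_finrank hk, hq]
  congr 1
  refine Nat.card_congr (Equiv.subtypeEquivRight fun S => ?_)
  rw [Module.natCard_eq_pow_finrank (K := K) (V := S), hq]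
  exact (Nat.pow_right_injective hq1).eq_iff

end Gauss

/-! ### Submodules of modules annihilated by `π`. -/

section Torsion

variable {R : Type*} [CommRing R] [Finite R] {π : R} {q s : ℕ}

namespace IsChainRing

variable (hR : IsChainRing R π q s)
include hR

theorem one_lt : 1 < q := by
  have := hR.isMaximal
  let _ : Field (R ⧸ Ideal.span {π}) := Ideal.Quotient.field _
  have : Finite (R ⧸ Ideal.span {π}) := Finite.of_surjective _ Ideal.Quotient.mk_surjective
  rw [← hR.card_residue]
  exact Finite.one_lt_card

variable {V : Type*} [AddCommGroup V] [Module R V] [Finite V]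

theorem exists_natCard_eq_pow (hV : ∀ v : V, π • v = 0) : ∃ d, Nat.card V = q ^ d := by
  have := hR.isMaximal
  let _ : Field (R ⧸ Ideal.span {π}) := Ideal.Quotient.field _
  have hV' : Module.IsTorsionBy R V π := fun v => hV v
  let _ : Module (R ⧸ Ideal.span {π}) V := hV'.module
  exact ⟨_, by rw [Module.natCard_eq_pow_finrank (K := R ⧸ Ideal.span {π}), hR.card_residue]⟩

/-- A module killed by `π` is a vector space over the residue field, with the same submodules. -/
theorem natCard_submodules {d k : ℕ} (hV : ∀ v : V, π • v = 0) (hd : Nat.card V = q ^ d)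
    (hk : k ≤ d) : (Nat.card {S : Submodule R V // Nat.card S = q ^ k} : ℝ) = gauss q d k := by
  have := hR.isMaximal
  let _ : Field (R ⧸ Ideal.span {π}) := Ideal.Quotient.field _
  have hV' : Module.IsTorsionBySet R V (Ideal.span {π} : Ideal R) :=
    (Module.isTorsionBySet_span_singleton_iff π).2 fun v => hV v
  let _ : Module (R ⧸ Ideal.span {π}) V := hV'.module
  have : IsScalarTower R (R ⧸ Ideal.span {π}) V := hV'.isScalarTower
  have : Finite (R ⧸ Ideal.span {π}) := Finite.of_surjective _ Ideal.Quotient.mk_surjective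
  rw [← natCard_subspaces (K := R ⧸ Ideal.span {π}) hR.card_residue hd hk]
  congr 1
  exact Nat.card_congr ((Submodule.orderIsoOfAlgebraMapSurjective (R := R)
    (S := R ⧸ Ideal.span {π}) (M := V) Ideal.Quotient.mk_surjective).toEquiv.subtypeEquiv
      fun S => Iff.rfl).symm

theorem natCard_between {U W : Submodule R V} (hUW : U ≤ W) (hW : ∀ v ∈ W, π • v = 0)
    {a l w : ℕ} (ha : Nat.card U = q ^ a) (hw : Nat.card W = q ^ w) (hal : a ≤ l) (hlw : l ≤ w) :
    (Nat.card {S : Submodule R V // U ≤ S ∧ S ≤ W ∧ Nat.card S = q ^ l} : ℝ) =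
      gauss q (w - a) (l - a) := by
  have hq := hR.one_lt
  let U' := U.comap W.subtype
  have hU' : Nat.card U' = q ^ a := by
    rw [← ha]
    exact Nat.card_congr (Submodule.comapSubtypeEquivOfLe hUW).toEquiv
  -- The correspondence between submodules of `W / U` and those between `U` and `W` multiplies sizes
  -- by `|U| = q ^ a`.
  have hcard : ∀ T : Submodule R (W ⧸ U'),
      Nat.card ((T.comap U'.mkQ).map W.subtype) = Nat.card T * q ^ a := by
    intro T
    rw [Nat.card_congr (Submodule.equivMapOfInjective W.subtype W.injective_subtype _).toEquiv.symm]
    let f : T.comap U'.mkQ →ₗ[R] T := U'.mkQ.restrict fun x hx => hx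
    have hf : Function.Surjective f := by
      rintro ⟨t, ht⟩
      obtain ⟨x, rfl⟩ := U'.mkQ_surjective t
      exact ⟨⟨x, ht⟩, rfl⟩
    rw [Submodule.card_eq_card_quotient_mul_card (LinearMap.ker f), mul_comm,
      Nat.card_congr (f.quotKerEquivOfSurjective hf).toEquiv, ← hU']
    congr 1
    refine Nat.card_congr ⟨fun x => ⟨x.1.1, ?_⟩, fun x => ⟨⟨x.1, ?_⟩, ?_⟩, fun x => rfl,
      fun x => rfl⟩
    · have := congrArg Subtype.val (LinearMap.mem_ker.1 x.2)
      exact (Submodule.Quotient.mk_eq_zero U').1 this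
    · have : U'.mkQ x.1 = 0 := (Submodule.Quotient.mk_eq_zero U').2 x.2
      rw [Submodule.mem_comap, this]
      exact T.zero_mem
    · exact LinearMap.mem_ker.2 (Subtype.ext ((Submodule.Quotient.mk_eq_zero U').2 x.2))
  have hquot : Nat.card (W ⧸ U') = q ^ (w - a) := by
    have := Submodule.card_eq_card_quotient_mul_card U'
    rw [hw, hU', ← pow_mul_pow_sub q (hal.trans hlw)] at this
    exact (Nat.eq_of_mul_eq_mul_left (by positivity) this).symm
  have : Finite (W ⧸ U') := Finite.of_surjective _ U'.mkQ_surjective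
  rw [← hR.natCard_submodules (V := W ⧸ U') (k := l - a) ?_ hquot (by omega)]
  · congr 1
    symm
    have hpow : ∀ c : ℕ, c = q ^ (l - a) ↔ c * q ^ a = q ^ l := fun c => by
      rw [← Nat.sub_add_cancel hal, pow_add, Nat.add_sub_cancel]
      exact (Nat.mul_left_inj (by positivity)).symm
    refine Nat.card_congr ⟨fun T => ⟨(T.1.comap U'.mkQ).map W.subtype, ?_,
      Submodule.map_subtype_le _ _, ?_⟩, fun S => ⟨(S.1.comap W.subtype).map U'.mkQ, ?_⟩, fun T => Subtype.ext ?_,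
      fun S => Subtype.ext ?_⟩
    · intro x hx
      refine ⟨⟨x, hUW hx⟩, ?_, rfl⟩
      have : U'.mkQ ⟨x, hUW hx⟩ = 0 := (Submodule.Quotient.mk_eq_zero U').2 hx
      rw [SetLike.mem_coe, Submodule.mem_comap, this]
      exact T.1.zero_mem
    · rw [hcard]
      exact (hpow _).1 T.2
    · rw [hpow, ← hcard, Submodule.comap_map_mkQ, sup_eq_right.2 (Submodule.comap_mono S.2.1),
        Submodule.map_comap_subtype, inf_eq_right.2 S.2.2.1, S.2.2.2]
    · change Submodule.map U'.mkQ (Submodule.comap W.subtype (Submodule.map W.subtype _)) = _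
      rw [Submodule.comap_map_eq_of_injective W.injective_subtype,
        Submodule.map_comap_eq_of_surjective U'.mkQ_surjective]
    · change Submodule.map W.subtype (Submodule.comap U'.mkQ (Submodule.map U'.mkQ _)) = _
      rw [Submodule.comap_map_mkQ, sup_eq_right.2 (Submodule.comap_mono S.2.1),
        Submodule.map_comap_subtype, inf_eq_right.2 S.2.2.1]
  · intro v
    obtain ⟨x, rfl⟩ := U'.mkQ_surjective v
    rw [← map_smul, show π • x = 0 from Subtype.ext (hW x.1 x.2), map_zero]

end IsChainRing

end Torsion

/-! ### Socles and multiples of submodules -/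

section Socle

variable {R : Type*} [CommRing R] {V : Type*} [AddCommGroup V] [Module R V]

/-- The elements of `L` that are annihilated by `π`. -/
def socle (π : R) (L : Submodule R V) : Submodule R V := L ⊓ Submodule.torsionBy R V π

/-- The submodule `π ^ i L`. -/
def powMul (π : R) (i : ℕ) (L : Submodule R V) : Submodule R V :=
  L.map (LinearMap.lsmul R V (π ^ i))

variable {π : R} {L M : Submodule R V}

theorem mem_socle {x : V} : x ∈ socle π L ↔ x ∈ L ∧ π • x = 0 := by
  rw [socle, Submodule.mem_inf, Submodule.mem_torsionBy_iff]

theorem mem_powMul {i : ℕ} {x : V} : x ∈ powMul π i L ↔ ∃ y ∈ L, π ^ i • y = x := by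
  simp [powMul]

theorem socle_le : socle π L ≤ L := inf_le_left

theorem socle_mono (h : L ≤ M) : socle π L ≤ socle π M := inf_le_inf_right _ h

theorem powMul_mono (i : ℕ) (h : L ≤ M) : powMul π i L ≤ powMul π i M := Submodule.map_mono h

theorem powMul_le (i : ℕ) : powMul π i L ≤ L := by
  intro x hx
  obtain ⟨y, hy, rfl⟩ := mem_powMul.1 hx
  exact L.smul_mem _ hy

theorem powMul_zero : powMul π 0 L = L := by
  ext x
  simp [mem_powMul]

theorem powMul_powMul (i j : ℕ) : powMul π i (powMul π j L) = powMul π (j + i) L := by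
  ext x
  simp only [mem_powMul]
  constructor
  · rintro ⟨_, ⟨y, hy, rfl⟩, rfl⟩
    exact ⟨y, hy, by rw [smul_smul, ← pow_add, add_comm]⟩
  · rintro ⟨y, hy, rfl⟩
    exact ⟨_, ⟨y, hy, rfl⟩, by rw [smul_smul, ← pow_add, add_comm]⟩

theorem socle_bot : socle π (⊥ : Submodule R V) = ⊥ := bot_inf_eq _

theorem powMul_bot (i : ℕ) : powMul π i (⊥ : Submodule R V) = ⊥ := Submodule.map_bot _

theorem finite_submodule [Finite V] : Finite (Submodule R V) :=
  Finite.of_injective _ SetLike.coe_injective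

theorem natCard_le_of_le [Finite V] (h : L ≤ M) : Nat.card L ≤ Nat.card M :=
  Nat.card_le_card_of_injective _ (Submodule.inclusion_injective h)

/-- The fibres of multiplication by `π` on `L` have the size of the socle. -/
theorem natCard_smul_eq {y : V} (hy : y ∈ powMul π 1 L) :
    Nat.card {x : V // x ∈ L ∧ π • x = y} = Nat.card (socle π L) := by
  obtain ⟨x₀, hx₀, rfl⟩ := mem_powMul.1 hy
  rw [pow_one]
  refine Nat.card_congr ⟨fun x => ⟨x.1 - x₀, mem_socle.2 ⟨L.sub_mem x.2.1 hx₀, ?_⟩⟩,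
    fun x => ⟨x.1 + x₀, L.add_mem (mem_socle.1 x.2).1 hx₀, ?_⟩, fun x => ?_, fun x => ?_⟩
  · rw [smul_sub, x.2.2, sub_self]
  · rw [smul_add, (mem_socle.1 x.2).2, zero_add]
  · simp
  · simp

/-- `L / πL` has the size of the socle of `L`. -/
theorem natCard_quotient_smul_top [Finite V] :
    Nat.card (L ⧸ (Ideal.span {π} • ⊤ : Submodule R L)) = Nat.card (socle π L) := by
  let f : L →ₗ[R] L := LinearMap.lsmul R L π
  have h1 : (Ideal.span {π} • ⊤ : Submodule R L) = LinearMap.range f := by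
    ext x
    rw [Submodule.ideal_span_singleton_smul, Submodule.mem_smul_pointwise_iff_exists]
    simp [f]
  have h2 : Nat.card (LinearMap.ker f) = Nat.card (socle π L) := by
    refine Nat.card_congr ⟨fun x => ⟨x.1.1, mem_socle.2 ⟨x.1.2, ?_⟩⟩,
      fun x => ⟨⟨x.1, (mem_socle.1 x.2).1⟩, ?_⟩, fun x => rfl, fun x => rfl⟩
    · exact congrArg Subtype.val (LinearMap.mem_ker.1 x.2)
    · exact LinearMap.mem_ker.2 (Subtype.ext (mem_socle.1 x.2).2)
  have h3 := Submodule.card_eq_card_quotient_mul_card (LinearMap.range f)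
  -- For multiplication by `π` on a finite module, cokernel and kernel have the same size.
  have h4 := Submodule.card_eq_card_quotient_mul_card (LinearMap.ker f)
  rw [Nat.card_congr f.quotKerEquivRange.toEquiv, h2] at h4
  rw [h1]
  have h5 : 0 < Nat.card (LinearMap.range f) := Nat.card_pos
  rw [h3, mul_comm (Nat.card (socle π L))] at h4
  exact Nat.eq_of_mul_eq_mul_left h5 h4

end Socle

/-! ### Counting submodules with prescribed socles. -/

namespace IsChainRing

variable {R : Type*} [CommRing R] [Finite R] {π : R} {q s : ℕ} (hR : IsChainRing R π q s)
variable {V : Type*} [AddCommGroup V] [Module R V] [Finite V]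
include hR

theorem exists_natCard_socle (L : Submodule R V) : ∃ r, Nat.card (socle π L) = q ^ r :=
  hR.exists_natCard_eq_pow fun v => Subtype.ext (mem_socle.1 v.2).2

/-- A submodule has minimal generators, as many as the dimension of its socle; their relations have
coefficients in the maximal ideal. -/
theorem exists_minimal_generators {L : Submodule R V} {r : ℕ}
    (hr : Nat.card (socle π L) = q ^ r) :
    ∃ l : Fin r → V, Submodule.span R (Set.range l) = L ∧
      ∀ c : Fin r → R, ∑ i, c i • l i = 0 → ∀ i, π ∣ c i := by
  have := hR.isMaximal
  let _ : Field (R ⧸ Ideal.span {π}) := Ideal.Quotient.field _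
  have : Finite (R ⧸ Ideal.span {π}) := Finite.of_surjective _ Ideal.Quotient.mk_surjective
  let P : Submodule R L := Ideal.span {π} • ⊤
  have : Finite (L ⧸ P) := Finite.of_surjective _ P.mkQ_surjective
  have hfin : Module.finrank (R ⧸ Ideal.span {π}) (L ⧸ P) = r := by
    apply Nat.pow_right_injective hR.one_lt
    simp only
    rw [← hr, ← natCard_quotient_smul_top,
      Module.natCard_eq_pow_finrank (K := R ⧸ Ideal.span {π}) (V := L ⧸ P), hR.card_residue]
  let b := Module.finBasisOfFinrankEq (R ⧸ Ideal.span {π}) (L ⧸ P) hfin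
  choose l hl using fun i => P.mkQ_surjective (b i)
  have hmk : ∀ c : Fin r → R, P.mkQ (∑ i, c i • l i) =
      ∑ i, (Ideal.Quotient.mk (Ideal.span {π}) (c i)) • b i := by
    intro c
    rw [map_sum]
    refine Finset.sum_congr rfl fun i _ => ?_
    rw [map_smul, hl]
    rfl
  have hspan : Submodule.span R (Set.range l) = ⊤ := by
    -- Nakayama: `π` is nilpotent, so `⟨π⟩` lies in the Jacobson radical, and lifts of a basis of `L
    -- / πL` generate `L`.
    refine top_le_iff.1 (Submodule.le_of_le_smul_of_le_jacobson_bot (I := Ideal.span {π})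
      (Module.finite_def.1 inferInstance) ?_ ?_)
    · rw [Ideal.span_singleton_le_iff_mem, Ideal.mem_jacobson_bot]
      intro y
      exact ((Commute.all π y).isNilpotent_mul_right ⟨s, hR.pow_eq_zero⟩).isUnit_add_one
    · intro x _
      choose c hc using fun i => Ideal.Quotient.mk_surjective (b.repr (P.mkQ x) i)
      have h1 : P.mkQ (∑ i, c i • l i) = P.mkQ x := by
        rw [hmk]
        simp only [hc]
        exact b.sum_repr _
      have h2 : x - ∑ i, c i • l i ∈ P := by
        rw [← Submodule.Quotient.mk_eq_zero]
        change P.mkQ _ = 0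
        rw [map_sub, h1, sub_self]
      refine Submodule.mem_sup.2 ⟨_, ?_, _, h2, add_sub_cancel _ _⟩
      exact Submodule.sum_mem _ fun i _ => Submodule.smul_mem _ _ (Submodule.subset_span ⟨i, rfl⟩)
  refine ⟨fun i => l i, ?_, fun c hc i => ?_⟩
  · have := congrArg (Submodule.map L.subtype) hspan
    rw [Submodule.map_span, Submodule.map_subtype_top, ← Set.range_comp] at this
    exact this
  · have h0 : ∑ i, c i • l i = 0 := Subtype.ext (by simpa using hc)
    have h1 := hmk c
    rw [h0, map_zero] at h1
    have h2 := Fintype.linearIndependent_iff.1 b.linearIndependent _ h1.symm i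
    rwa [Ideal.Quotient.eq_zero_iff_mem, Ideal.mem_span_singleton] at h2

/-- The socle has the size of `L / πL`, which `n` vectors span over the residue field. -/
theorem natCard_socle_span_le {n : ℕ} (v : Fin n → V) :
    Nat.card (socle π (Submodule.span R (Set.range v))) ≤ q ^ n := by
  set L := Submodule.span R (Set.range v) with hL
  let P : Submodule R L := Ideal.span {π} • ⊤
  have : Finite (R ⧸ Ideal.span {π}) := Finite.of_surjective _ Ideal.Quotient.mk_surjective
  let l : Fin n → L := fun i => ⟨v i, Submodule.subset_span ⟨i, rfl⟩⟩
  rw [← natCard_quotient_smul_top, ← hR.card_residue,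
    show Nat.card (R ⧸ Ideal.span {π}) ^ n = Nat.card (Fin n → R ⧸ Ideal.span {π}) by
      rw [Nat.card_fun, Nat.card_fin]]
  refine Nat.card_le_card_of_surjective (fun c => ∑ i, c i • P.mkQ (l i)) fun x => ?_
  obtain ⟨⟨x, hx⟩, rfl⟩ := P.mkQ_surjective x
  obtain ⟨c, rfl⟩ := (Submodule.mem_span_range_iff_exists_fun R).1 hx
  refine ⟨fun i => Ideal.Quotient.mk _ (c i), ?_⟩
  have : (⟨∑ i, c i • v i, hx⟩ : L) = ∑ i, c i • l i := Subtype.ext (by simp [l])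
  rw [this, map_sum]
  exact Finset.sum_congr rfl fun i _ => (map_smul P.mkQ (c i) (l i)).symm

/-- The number of `L ≤ M` with given `πL` and given socle. -/
theorem natCard_with_socle {M L' S : Submodule R V} (hL' : L' ≤ powMul π 1 M)
    (hS : socle π L' ≤ S) (hSM : S ≤ socle π M) {a l w : ℕ}
    (ha : Nat.card (socle π L') = q ^ a) (hl : Nat.card S = q ^ l)
    (hw : Nat.card (socle π M) = q ^ w) :
    Nat.card {L : Submodule R V // L ≤ M ∧ powMul π 1 L = L' ∧ socle π L = S} =
      q ^ ((w - l) * a) := by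
  have : Finite (Submodule R V) := finite_submodule
  have hq := hR.one_lt
  obtain ⟨g, hg, hrel⟩ := hR.exists_minimal_generators ha
  have hgmem : ∀ i, g i ∈ L' := fun i => hg ▸ Submodule.subset_span ⟨i, rfl⟩
  -- Any lift `t` of the minimal generators `g` to `M`, together with `S`, spans a submodule of the
  -- desired kind.
  have hspan : ∀ t : Fin a → V, (∀ i, t i ∈ M ∧ π • t i = g i) →
      Submodule.span R (Set.range t) ⊔ S ≤ M ∧
      powMul π 1 (Submodule.span R (Set.range t) ⊔ S) = L' ∧
      socle π (Submodule.span R (Set.range t) ⊔ S) = S := by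
    intro t ht
    have hSz : ∀ x ∈ S, π • x = 0 := fun x hx => (mem_socle.1 (hSM hx)).2
    refine ⟨sup_le (Submodule.span_le.2 ?_) (hSM.trans socle_le), ?_, ?_⟩
    · rintro _ ⟨i, rfl⟩
      exact (ht i).1
    · rw [powMul, Submodule.map_sup, Submodule.map_span, ← Set.range_comp, ← hg]
      have h1 : (LinearMap.lsmul R V (π ^ 1) ∘ t) = g := by
        funext i
        simpa using (ht i).2
      have h2 : Submodule.map (LinearMap.lsmul R V (π ^ 1)) S = ⊥ := by
        refine le_bot_iff.1 (Submodule.map_le_iff_le_comap.2 fun x hx => ?_)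
        simpa using hSz x hx
      rw [h2, sup_bot_eq]
      exact congrArg (fun g => Submodule.span R (Set.range g)) h1
    -- If `π` kills `∑ c i • t i + z`, then `∑ c i • g i = 0`, so minimality gives `π ∣ c i`. Hence
    -- `∑ c i • t i` lies in the socle of `L'`, which is inside `S`.
    · refine le_antisymm (fun x hx => ?_) fun x hx => mem_socle.2
        ⟨Submodule.mem_sup_right hx, hSz x hx⟩
      obtain ⟨hx1, hx2⟩ := mem_socle.1 hx
      obtain ⟨y, hy, z, hz, rfl⟩ := Submodule.mem_sup.1 hx1
      obtain ⟨c, rfl⟩ := (Submodule.mem_span_range_iff_exists_fun R).1 hy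
      refine S.add_mem (hS (mem_socle.2 ⟨?_, ?_⟩)) hz
      · have h0 : ∑ i, c i • g i = 0 := by
          rw [smul_add, hSz z hz, add_zero, Finset.smul_sum] at hx2
          rw [← hx2]
          refine Finset.sum_congr rfl fun i _ => ?_
          rw [← (ht i).2, smul_comm]
        refine L'.sum_mem fun i _ => ?_
        obtain ⟨d, hd⟩ := hrel c h0 i
        rw [hd, mul_comm, mul_smul, (ht i).2]
        exact L'.smul_mem _ (hgmem i)
      · rwa [smul_add, hSz z hz, add_zero] at hx2
  let F := {L : Submodule R V // L ≤ M ∧ powMul π 1 L = L' ∧ socle π L = S}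
  -- Conversely, each `L` is recovered from any lift inside it: subtracting the combination with the
  -- same multiple by `π` leaves an element of the socle `S`.
  have hF : ∀ (L : F) (t : Fin a → V), (∀ i, t i ∈ L.1 ∧ π • t i = g i) →
      L.1 = Submodule.span R (Set.range t) ⊔ S := by
    rintro ⟨L, hLM, hL, hLS⟩ t ht
    change L = _
    refine le_antisymm (fun x hx => ?_) (sup_le (Submodule.span_le.2 ?_) (hLS ▸ socle_le))
    · have h1 : π • x ∈ L' := hL ▸ mem_powMul.2 ⟨x, hx, by rw [pow_one]⟩
      rw [← hg] at h1
      obtain ⟨c, hc⟩ := (Submodule.mem_span_range_iff_exists_fun R).1 h1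
      have h2 : ∑ i, c i • t i ∈ Submodule.span R (Set.range t) :=
        Submodule.sum_mem _ fun i _ => Submodule.smul_mem _ _ (Submodule.subset_span ⟨i, rfl⟩)
      have h3 : x - ∑ i, c i • t i ∈ S := by
        rw [← hLS]
        refine mem_socle.2 ⟨L.sub_mem hx (L.sum_mem fun i _ => L.smul_mem _ (ht i).1), ?_⟩
        rw [smul_sub, ← hc, Finset.smul_sum, ← Finset.sum_sub_distrib]
        refine Finset.sum_eq_zero fun i _ => ?_
        rw [← (ht i).2, smul_comm, sub_self]
      exact Submodule.mem_sup.2 ⟨_, h2, _, h3, add_sub_cancel _ _⟩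
    · rintro _ ⟨i, rfl⟩
      exact (ht i).1
  have htuples : ∀ (N : Submodule R V) (k : ℕ), L' ≤ powMul π 1 N → Nat.card (socle π N) = q ^ k →
      Nat.card {t : Fin a → V // ∀ i, t i ∈ N ∧ π • t i = g i} = q ^ (k * a) := by
    intro N k hN hk
    rw [Nat.card_congr (Equiv.subtypePiEquivPi (p := fun i x => x ∈ N ∧ π • x = g i)), Nat.card_pi,
      Finset.prod_congr rfl fun i _ => (natCard_smul_eq (hN (hgmem i))).trans hk,
      Finset.prod_const, Finset.card_univ, Fintype.card_fin, pow_mul]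
  -- Double count: `q ^ (w * a)` lifts to `M`, of which exactly `q ^ (l * a)` lie in each `L`.
  have e : {t : Fin a → V // ∀ i, t i ∈ M ∧ π • t i = g i} ≃
      Σ L : F, {t : Fin a → V // ∀ i, t i ∈ L.1 ∧ π • t i = g i} :=
    { toFun := fun t => ⟨⟨_, hspan t.1 t.2⟩, t.1, fun i =>
        ⟨Submodule.mem_sup_left (Submodule.subset_span ⟨i, rfl⟩), (t.2 i).2⟩⟩
      invFun := fun x => ⟨x.2.1, fun i => ⟨x.1.2.1 (x.2.2 i).1, (x.2.2 i).2⟩⟩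
      left_inv := fun t => rfl
      right_inv := by
        rintro ⟨⟨L, hL⟩, t, ht⟩
        obtain rfl := hF ⟨L, hL⟩ t ht
        rfl }
  have hcount := Nat.card_congr e
  have : Fintype F := Fintype.ofFinite _
  rw [htuples M w hL' hw, Nat.card_sigma,
    Finset.sum_congr rfl fun L _ => htuples L.1 l L.2.2.1.ge (L.2.2.2.symm ▸ hl), Finset.sum_const,
    Finset.card_univ, smul_eq_mul, ← Nat.card_eq_fintype_card] at hcount
  have hlw : l ≤ w := (Nat.pow_le_pow_iff_right hq).1 (hl ▸ hw ▸ natCard_le_of_le hSM)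
  have : w * a = (w - l) * a + l * a := by rw [← add_mul, Nat.sub_add_cancel hlw]
  rw [this, pow_add] at hcount
  exact (Nat.eq_of_mul_eq_mul_right (by positivity) hcount).symm

/-- The number of `L ≤ M` with given `πL` and given dimension of the socle. -/
theorem natCard_with_socle_rank {M L' : Submodule R V} (hL' : L' ≤ powMul π 1 M) {a l w : ℕ}
    (ha : Nat.card (socle π L') = q ^ a) (hw : Nat.card (socle π M) = q ^ w) (hal : a ≤ l)
    (hlw : l ≤ w) :
    (Nat.card {L : Submodule R V // L ≤ M ∧ powMul π 1 L = L' ∧ Nat.card (socle π L) = q ^ l} : ℝ)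
      = q ^ ((w - l) * a) * gauss q (w - a) (l - a) := by
  have : Finite (Submodule R V) := finite_submodule
  let F := {S : Submodule R V // socle π L' ≤ S ∧ S ≤ socle π M ∧ Nat.card S = q ^ l}
  have : Fintype F := Fintype.ofFinite _
  have e : {L : Submodule R V // L ≤ M ∧ powMul π 1 L = L' ∧ Nat.card (socle π L) = q ^ l} ≃
      Σ S : F, {L : Submodule R V // L ≤ M ∧ powMul π 1 L = L' ∧ socle π L = S.1} :=
    { toFun := fun L => ⟨⟨socle π L.1, socle_mono (L.2.2.1.symm.le.trans (powMul_le 1)),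
        socle_mono L.2.1, L.2.2.2⟩, L.1, L.2.1, L.2.2.1, rfl⟩
      invFun := fun x => ⟨x.2.1, x.2.2.1, x.2.2.2.1,
        (congrArg (fun S : Submodule R V => Nat.card S) x.2.2.2.2).trans x.1.2.2.2⟩
      left_inv := fun L => rfl
      right_inv := by
        rintro ⟨⟨S, hS⟩, L, h1, h2, h3⟩
        obtain rfl : socle π L = S := h3
        rfl }
  rw [Nat.card_congr e, Nat.card_sigma, Finset.sum_congr rfl fun S _ =>
    hR.natCard_with_socle hL' S.2.1 S.2.2.1 ha S.2.2.2 hw, Finset.sum_const, Finset.card_univ,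
    smul_eq_mul, ← Nat.card_eq_fintype_card, Nat.cast_mul, mul_comm, Nat.cast_pow,
    hR.natCard_between (socle_mono (hL'.trans (powMul_le 1))) (fun v hv => (mem_socle.1 hv).2) ha hw
      hal hlw]

/-- The number of `L ≤ M` with given dimensions of the socles of all `π ^ i L`. -/
theorem natCard_with_ranks (t : ℕ) {M : Submodule R V} (hM : powMul π t M = ⊥) {ν κ : ℕ → ℕ}
    (hν : ∀ i, Nat.card (socle π (powMul π i M)) = q ^ ν i) (hκν : ∀ i, κ i ≤ ν i)
    (hκ : Antitone κ) (hκt : ∀ i, t ≤ i → κ i = 0) :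
    (Nat.card {L : Submodule R V // L ≤ M ∧ ∀ i, Nat.card (socle π (powMul π i L)) = q ^ κ i} : ℝ)
      = ∏ i ∈ Finset.range t, (q : ℝ) ^ ((ν i - κ i) * κ (i + 1)) *
          gauss q (ν i - κ (i + 1)) (κ i - κ (i + 1)) := by
  have : Finite (Submodule R V) := finite_submodule
  induction t generalizing M ν κ with
  | zero =>
    rw [powMul_zero] at hM
    subst hM
    rw [Finset.prod_range_zero, Nat.cast_eq_one, Nat.card_eq_one_iff_unique]
    refine ⟨⟨fun L L' => Subtype.ext ?_⟩, ⟨⟨⊥, le_rfl, fun i => ?_⟩⟩⟩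
    · rw [le_bot_iff.1 L.2.1, le_bot_iff.1 L'.2.1]
    · rw [powMul_bot, socle_bot, hκt i (Nat.zero_le i), pow_zero, Nat.card_unique]
  | succ t ih =>
    let F := {L' : Submodule R V // L' ≤ powMul π 1 M ∧
      ∀ i, Nat.card (socle π (powMul π i L')) = q ^ κ (i + 1)}
    have : Fintype F := Fintype.ofFinite _
    -- Submodules are fibred over `L' = πL`, whose data are those of `L` shifted by one; the fibre
    -- size does not depend on `L'`.
    have e : {L : Submodule R V // L ≤ M ∧ ∀ i, Nat.card (socle π (powMul π i L)) = q ^ κ i} ≃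
        Σ L' : F, {L : Submodule R V // L ≤ M ∧ powMul π 1 L = L'.1 ∧
          Nat.card (socle π L) = q ^ κ 0} :=
      { toFun := fun L => ⟨⟨powMul π 1 L.1, powMul_mono 1 L.2.1, fun i => by
            rw [powMul_powMul, add_comm]; exact L.2.2 (i + 1)⟩, L.1, L.2.1, rfl, by
            have := L.2.2 0
            rwa [powMul_zero] at this⟩
        invFun := fun x => ⟨x.2.1, x.2.2.1, fun i => by
          rcases i with _ | i
          · rw [powMul_zero]; exact x.2.2.2.2
          · rw [add_comm i 1, ← powMul_powMul, x.2.2.2.1, x.1.2.2 i, add_comm]⟩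
        left_inv := fun L => rfl
        right_inv := by
          rintro ⟨⟨L', hL'⟩, L, h1, h2, h3⟩
          obtain rfl : powMul π 1 L = L' := h2
          rfl }
    have hL : ∀ L' : F, (Nat.card {L : Submodule R V // L ≤ M ∧ powMul π 1 L = L'.1 ∧
        Nat.card (socle π L) = q ^ κ 0} : ℝ) =
        q ^ ((ν 0 - κ 0) * κ 1) * gauss q (ν 0 - κ 1) (κ 0 - κ 1) := fun L' => by
      have h0 := L'.2.2 0
      have hν0 := hν 0
      rw [powMul_zero] at h0 hν0
      exact hR.natCard_with_socle_rank L'.2.1 h0 hν0 (hκ (Nat.zero_le 1)) (hκν 0)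
    rw [Nat.card_congr e, Nat.card_sigma, Nat.cast_sum, Finset.sum_congr rfl fun L' _ => hL L',
      Finset.sum_const, Finset.card_univ, nsmul_eq_mul, ← Nat.card_eq_fintype_card,
      Finset.prod_range_succ']
    congr 1
    refine ih (M := powMul π 1 M) (ν := fun i => ν (i + 1)) (κ := fun i => κ (i + 1)) ?_ ?_
      (fun i => hκν _) (fun i j hij => hκ (by omega)) (fun i hi => hκt _ (by omega))
    · rw [powMul_powMul, add_comm, hM]
    · intro i
      rw [powMul_powMul, add_comm]
      exact hν (i + 1)

end IsChainRing

/-! ### Shapes and socle dimensions -/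

section Shape

variable {s : ℕ}

/-- The components of `κ` in reverse order, continued by `0`. -/
def revExtend (κ : Fin s → ℕ) (i : ℕ) : ℕ := if h : i < s then κ (Fin.rev ⟨i, h⟩) else 0

theorem revExtend_of_le (κ : Fin s → ℕ) {i : ℕ} (h : s ≤ i) : revExtend κ i = 0 :=
  dif_neg (not_lt.2 h)

theorem revExtend_rev (κ : Fin s → ℕ) (i : Fin s) : revExtend κ (Fin.rev i : Fin s) = κ i := by
  rw [revExtend, dif_pos (Fin.rev i).2, Fin.eta, Fin.rev_rev]

theorem revExtend_rev_succ (κ : Fin s → ℕ) (i : Fin s) :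
    revExtend κ ((Fin.rev i : Fin s) + 1) = prevComponent κ i := by
  unfold revExtend prevComponent
  have hi := i.2
  by_cases h : (i : ℕ) = 0
  · rw [if_pos h, dif_neg]
    rw [Fin.val_rev]
    omega
  · rw [if_neg h, dif_pos (show (Fin.rev i : ℕ) + 1 < s by rw [Fin.val_rev]; omega)]
    congr 1
    ext
    simp only [Fin.val_rev]
    omega

theorem antitone_revExtend {κ : Fin s → ℕ} (hκ : ∀ i j, i ≤ j → κ i ≤ κ j) :
    Antitone (revExtend κ) := by
  intro i j hij
  unfold revExtend
  split_ifs with h1 h2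
  · exact hκ _ _ (Fin.rev_le_rev.2 hij)
  · omega
  · exact Nat.zero_le _
  · exact le_rfl

theorem revExtend_mono {κ μ : Fin s → ℕ} (h : ∀ i, κ i ≤ μ i) (i : ℕ) :
    revExtend κ i ≤ revExtend μ i := by
  unfold revExtend
  split_ifs
  · exact h _
  · exact le_rfl

theorem shapeChoose_eq_prod_range (q : ℝ) (μ κ : Fin s → ℕ) :
    shapeChoose q μ κ = ∏ i ∈ Finset.range s,
      q ^ ((revExtend μ i - revExtend κ i) * revExtend κ (i + 1)) *
        gauss q (revExtend μ i - revExtend κ (i + 1)) (revExtend κ i - revExtend κ (i + 1)) := by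
  rw [Finset.prod_range, shapeChoose, ← Equiv.prod_comp Fin.revPerm]
  refine (Finset.prod_congr rfl fun i _ => ?_)
  have h1 := revExtend_rev μ (Fin.rev i)
  have h2 := revExtend_rev κ (Fin.rev i)
  have h3 := revExtend_rev_succ κ (Fin.rev i)
  rw [Fin.rev_rev] at h1 h2 h3
  rw [h1, h2, h3, Fin.revPerm_apply]

theorem mem_subshapes {n : ℕ} {μ κ : Fin s → ℕ} :
    κ ∈ subshapes n μ ↔ (∀ i, κ i ≤ n ∧ κ i ≤ μ i) ∧ ∀ i j, i ≤ j → κ i ≤ κ j := by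
  simp [subshapes]

/-- Coordinate `j` of `π ^ i R^μ` ranges over `⟨π ^ (shapeExponent μ j + i)⟩`. The lemma says which
coordinates survive: the first `μ_{s-i}`. -/
theorem shapeExponent_add_lt_iff {μ : Fin s → ℕ} (hμ : IsShape μ) (i j : ℕ) :
    shapeExponent μ j + i < s ↔ j < revExtend μ i := by
  by_cases hi : i < s
  swap
  · rw [revExtend_of_le μ (not_lt.1 hi)]
    omega
  rw [revExtend, dif_pos hi]
  set t := Fin.rev ⟨i, hi⟩ with ht
  have htv : (t : ℕ) = s - (i + 1) := Fin.val_rev _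
  constructor
  · intro h
    by_contra! hle
    have : Finset.Iic t ⊆ Finset.univ.filter fun k => μ k ≤ j := fun k hk => by
      rw [Finset.mem_filter]
      exact ⟨Finset.mem_univ _, (hμ k t (Finset.mem_Iic.1 hk)).trans hle⟩
    have := Finset.card_le_card this
    rw [Fin.card_Iic] at this
    unfold shapeExponent at h
    omega
  · intro h
    have : (Finset.univ.filter fun k => μ k ≤ j) ⊆ Finset.Iio t := fun k hk => by
      rw [Finset.mem_filter] at hk
      rw [Finset.mem_Iio]
      by_contra! hle
      have := hμ t k hle
      omega
    have := Finset.card_le_card this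
    rw [Fin.card_Iio] at this
    unfold shapeExponent
    omega

theorem revExtend_le_packetLength (μ : Fin s → ℕ) (i : ℕ) : revExtend μ i ≤ packetLength μ := by
  unfold revExtend
  split_ifs
  · exact Finset.le_sup (f := μ) (Finset.mem_univ _)
  · exact Nat.zero_le _

end Shape

/-! ### Counting the row spans inside `R^μ`. -/

section Count

variable {R : Type*} [CommRing R] {π : R} {q s : ℕ}

theorem IsChainRing.powMul_eq_bot (hR : IsChainRing R π q s) {V : Type*}
    [AddCommGroup V] [Module R V] {i : ℕ} (hi : s ≤ i) (L : Submodule R V) : powMul π i L = ⊥ := by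
  refine le_bot_iff.1 fun x hx => ?_
  obtain ⟨y, -, rfl⟩ := mem_powMul.1 hx
  rw [pow_eq_zero_of_le hi hR.pow_eq_zero, zero_smul]
  exact Submodule.zero_mem _

theorem mem_shapeModule {μ : Fin s → ℕ} {v : Fin (packetLength μ) → R} :
    v ∈ shapeModule π μ ↔ ∀ j : Fin (packetLength μ), π ^ shapeExponent μ (j : ℕ) ∣ v j := by
  simp [shapeModule, Submodule.mem_pi, Ideal.mem_span_singleton]

/-- The annihilator of `π ^ (s - 1)` is `⟨π⟩`, so the ideal `⟨π ^ (s - 1)⟩` is a copy of the residue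
field. -/
theorem IsChainRing.natCard_multiples (hR : IsChainRing R π q s) :
    Nat.card {x : R // π ^ (s - 1) ∣ x} = q := by
  have hs := hR.pos
  let f : R →ₗ[R] R := LinearMap.lsmul R R (π ^ (s - 1))
  have hker : LinearMap.ker f = Ideal.span {π} := by
    ext x
    rw [LinearMap.mem_ker, Ideal.mem_span_singleton]
    change π ^ (s - 1) * x = 0 ↔ _
    constructor
    · intro h
      have := hR.dvd_of_pow_mul_eq_zero h
      rwa [Nat.sub_sub_self hs, pow_one] at this
    · rintro ⟨c, rfl⟩
      rw [← mul_assoc, ← pow_succ, Nat.sub_add_cancel hs, hR.pow_eq_zero, zero_mul]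
  rw [← hR.card_residue, ← hker, Nat.card_congr f.quotKerEquivRange.toEquiv]
  refine Nat.card_congr (Equiv.subtypeEquivRight fun x => ?_)
  rw [LinearMap.mem_range]
  exact ⟨fun ⟨c, hc⟩ => ⟨c, hc.symm⟩, fun ⟨c, hc⟩ => ⟨c, hc.symm⟩⟩

/-- Membership is coordinatewise: each surviving coordinate contributes the minimal ideal `⟨π ^ (s -
1)⟩`, every other one only `0`. -/
theorem IsChainRing.mem_socle_powMul_shapeModule (hR : IsChainRing R π q s) {μ : Fin s → ℕ}
    (hμ : IsShape μ) (i : ℕ) {v : Fin (packetLength μ) → R} :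
    v ∈ socle π (powMul π i (shapeModule π μ)) ↔
      ∀ j : Fin (packetLength μ), (if (j : ℕ) < revExtend μ i then π ^ (s - 1) else 0) ∣ v j := by
  have hs := hR.pos
  rw [mem_socle, mem_powMul]
  constructor
  · rintro ⟨⟨w, hw, rfl⟩, h0⟩ j
    split_ifs with hj
    · have := hR.dvd_of_pow_mul_eq_zero (l := 1) (a := π ^ i * w j) (by
        rw [pow_one]; exact congrFun h0 j)
      exact this
    · rw [← shapeExponent_add_lt_iff hμ, not_lt] at hj
      rw [zero_dvd_iff]
      obtain ⟨c, hc⟩ := mem_shapeModule.1 hw j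
      rw [Pi.smul_apply, hc, smul_eq_mul, ← mul_assoc, ← pow_add, add_comm,
        pow_eq_zero_of_le hj hR.pow_eq_zero, zero_mul]
  · intro h
    have hdvd : ∀ j : Fin (packetLength μ), π ^ i * π ^ shapeExponent μ (j : ℕ) ∣ v j := fun j => by
      have := h j
      split_ifs at this with hj
      · rw [← shapeExponent_add_lt_iff hμ] at hj
        refine Dvd.dvd.trans ?_ this
        rw [← pow_add]
        exact pow_dvd_pow π (by omega)
      · rw [zero_dvd_iff.1 this]
        exact dvd_zero _
    choose c hc using hdvd
    refine ⟨⟨fun j => π ^ shapeExponent μ (j : ℕ) * c j,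
      mem_shapeModule.2 fun j => ⟨_, rfl⟩, ?_⟩, ?_⟩
    · ext j
      rw [hc, Pi.smul_apply, smul_eq_mul, mul_assoc]
    · ext j
      have := h j
      rw [Pi.smul_apply, smul_eq_mul, Pi.zero_apply]
      split_ifs at this with hj
      · obtain ⟨d, hd⟩ := this
        rw [hd, ← mul_assoc, ← pow_succ', Nat.sub_add_cancel hs, hR.pow_eq_zero, zero_mul]
      · rw [zero_dvd_iff.1 this, mul_zero]

theorem IsChainRing.natCard_socle_powMul_shapeModule (hR : IsChainRing R π q s) {μ : Fin s → ℕ}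
    (hμ : IsShape μ) (i : ℕ) :
    Nat.card (socle π (powMul π i (shapeModule π μ))) = q ^ revExtend μ i := by
  let p : ∀ _ : Fin (packetLength μ), R → Prop := fun j x =>
    (if (j : ℕ) < revExtend μ i then π ^ (s - 1) else 0) ∣ x
  have h1 : Nat.card (socle π (powMul π i (shapeModule π μ))) =
      Nat.card {v : Fin (packetLength μ) → R // ∀ j, p j (v j)} :=
    Nat.card_congr (Equiv.subtypeEquivRight fun v => hR.mem_socle_powMul_shapeModule hμ i)
  have h2 : ∀ j, Nat.card {x // p j x} = if (j : ℕ) < revExtend μ i then q else 1 := by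
    intro j
    simp only [p]
    split_ifs
    · exact hR.natCard_multiples
    · simp [zero_dvd_iff]
  rw [h1, Nat.card_congr Equiv.subtypePiEquivPi, Nat.card_pi, Finset.prod_congr rfl fun j _ => h2 j,
    Finset.prod_ite, Finset.prod_const, Finset.prod_const_one, mul_one]
  congr 1
  have := revExtend_le_packetLength μ i
  rw [← Fintype.card_subtype, Fintype.card_congr (Fin.castLEquiv this).symm, Fintype.card_fin]

variable [Finite R]

/-- Being generated by `n` elements is a bound on the socle; minimal generators padded with zero
rows give the matrix. -/
theorem IsChainRing.range_rowSpan (hR : IsChainRing R π q s) (n : ℕ) (μ : Fin s → ℕ) :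
    Set.range (fun X : ShapeMatrix π n μ => rowSpan X.1) =
      {L | L ≤ shapeModule π μ ∧ Nat.card (socle π L) ≤ q ^ n} := by
  ext L
  constructor
  · rintro ⟨X, rfl⟩
    exact ⟨forall_row_mem_iff.1 X.2, hR.natCard_socle_span_le _⟩
  · rintro ⟨hL, hn⟩
    obtain ⟨r, hr⟩ := hR.exists_natCard_socle L
    obtain ⟨g, hg, -⟩ := hR.exists_minimal_generators hr
    rw [hr, Nat.pow_le_pow_iff_right hR.one_lt] at hn
    let A : Matrix (Fin n) (Fin (packetLength μ)) R :=
      Matrix.of fun i => if h : (i : ℕ) < r then g ⟨i, h⟩ else 0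
    have hA : rowSpan A = L := by
      refine le_antisymm (forall_row_mem_iff.1 fun i => ?_) ?_
      · change (if h : (i : ℕ) < r then g ⟨i, h⟩ else 0) ∈ L
        split_ifs
        · exact hg ▸ Submodule.subset_span ⟨_, rfl⟩
        · exact L.zero_mem
      · rw [← hg, Submodule.span_le]
        rintro _ ⟨i, rfl⟩
        have : A (Fin.castLE hn i) = g i := dif_pos i.2
        exact this ▸ row_mem_rowSpan A _
    exact ⟨⟨A, forall_row_mem_iff.2 (hA.le.trans hL)⟩, hA⟩

theorem IsChainRing.ncard_range_rowSpan (hR : IsChainRing R π q s) (n : ℕ) {μ : Fin s → ℕ}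
    (hμ : IsShape μ) :
    ((Set.range fun X : ShapeMatrix π n μ => rowSpan X.1).ncard : ℝ) =
      ∑ κ ∈ subshapes n μ, shapeChoose q μ κ := by
  have hq := hR.one_lt
  have : Finite (Submodule R (Fin (packetLength μ) → R)) := finite_submodule
  let M := shapeModule π μ
  choose ρ hρ using fun L : Submodule R (Fin (packetLength μ) → R) =>
    fun i : ℕ => hR.exists_natCard_socle (powMul π i L)
  have hρ_le : ∀ {L L'} {i i' : ℕ}, powMul π i L ≤ powMul π i' L' → ρ L i ≤ ρ L' i' := by
    intro L L' i i' h
    rw [← Nat.pow_le_pow_iff_right hq, ← hρ, ← hρ]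
    exact natCard_le_of_le (socle_mono h)
  have hρM : ∀ i, ρ M i = revExtend μ i := fun i =>
    Nat.pow_right_injective hq ((hρ M i).symm.trans (hR.natCard_socle_powMul_shapeModule hμ i))
  have hρ0 : ∀ {L} {i : ℕ}, s ≤ i → ρ L i = 0 := fun {L i} hi =>
    Nat.pow_right_injective hq (show q ^ ρ L i = q ^ 0 by
      rw [← hρ, hR.powMul_eq_bot hi, socle_bot, pow_zero, Nat.card_unique])
  -- The order is reversed because socle dimensions of `π ^ i L` decrease in `i`, whereas shapes
  -- increase.
  let shape : Submodule R (Fin (packetLength μ) → R) → Fin s → ℕ := fun L i =>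
    ρ L (Fin.rev i : Fin s)
  have hshape : ∀ L κ, shape L = κ ↔
      ∀ i, Nat.card (socle π (powMul π i L)) = q ^ revExtend κ i := by
    intro L κ
    constructor
    · rintro rfl i
      rw [hρ]
      by_cases hi : i < s
      · rw [revExtend, dif_pos hi]
        simp only [shape, Fin.rev_rev]
      · rw [hρ0 (not_lt.1 hi), revExtend_of_le _ (not_lt.1 hi)]
    · intro h
      funext i
      have := (hρ L _).symm.trans (h (Fin.rev i : Fin s))
      rw [revExtend_rev] at this
      exact Nat.pow_right_injective hq this
  have hn : ∀ L, Nat.card (socle π L) ≤ q ^ n ↔ ρ L 0 ≤ n := fun L => by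
    have := hρ L 0
    rw [powMul_zero] at this
    rw [this, Nat.pow_le_pow_iff_right hq]
  classical
  have : Fintype (Submodule R (Fin (packetLength μ) → R)) := Fintype.ofFinite _
  have hset : (Set.range fun X : ShapeMatrix π n μ => rowSpan X.1).ncard =
      (Finset.univ.filter fun L => L ≤ M ∧ Nat.card (socle π L) ≤ q ^ n).card := by
    rw [hR.range_rowSpan, ← Set.ncard_coe_finset]
    congr 1
    ext; simp [M]
  rw [hset, Finset.card_eq_sum_card_fiberwise (f := shape) (t := subshapes n μ), Nat.cast_sum]
  · refine Finset.sum_congr rfl fun κ hκ => ?_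
    obtain ⟨hκ1, hκ2⟩ := mem_subshapes.1 hκ
    rw [shapeChoose_eq_prod_range, ← hR.natCard_with_ranks s (M := M) (hR.powMul_eq_bot le_rfl M)
      (hR.natCard_socle_powMul_shapeModule hμ) (revExtend_mono fun i => (hκ1 i).2)
      (antitone_revExtend hκ2) fun i => revExtend_of_le κ]
    rw [Nat.card_eq_fintype_card, Fintype.card_subtype, Finset.filter_filter]
    congr 2
    ext L
    simp only [Finset.mem_filter, Finset.mem_univ, true_and]
    rw [← hshape]
    constructor
    · rintro ⟨⟨h1, -⟩, h2⟩
      exact ⟨h1, h2⟩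
    · rintro ⟨h1, rfl⟩
      refine ⟨⟨h1, (hn L).2 ?_⟩, rfl⟩
      have := (hκ1 (Fin.rev ⟨0, hR.pos⟩)).1
      simpa only [shape, Fin.rev_rev] using this
  -- The shape is a valid index: `π ^ i L ≤ L` bounds it by `n`, `π ^ i L ≤ π ^ i M` bounds it by
  -- `μ`, and the chain of the `π ^ i L` makes it monotone.
  · intro L hL
    obtain ⟨h1, h2⟩ := (Finset.mem_filter.1 hL).2
    rw [hn] at h2
    refine mem_subshapes.2 ⟨fun i => ⟨?_, ?_⟩, fun i j hij => ?_⟩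
    · refine (hρ_le (i' := 0) ?_).trans h2
      rw [powMul_zero]
      exact powMul_le _
    · rw [← revExtend_rev μ i, ← hρM]
      exact hρ_le (powMul_mono _ h1)
    · refine hρ_le ?_
      have : (Fin.rev j : ℕ) ≤ (Fin.rev i : ℕ) := Fin.rev_le_rev.2 hij
      rw [← Nat.add_sub_cancel' this, ← powMul_powMul]
      exact powMul_le _

end Count

end ChainRing

/-! ### The capacity theorem. -/

theorem mainTheorem6 {R : Type*} [CommRing R] [Finite R] (π : R) (q s : ℕ)
    (hR : IsChainRing R π q s) (T : Set R) (hT : IsResidueSystem π T)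
    (n N : ℕ) (hnN : n ≤ N) (μ : Fin s → ℕ) (hμ : IsShape μ) :
    -- the capacity of the channel
    IsCapacity q (mmc π N n μ) (Real.logb q (∑ κ ∈ subshapes n μ, shapeChoose q μ κ)) ∧
    -- the uniform distribution on the code attains the capacity
    uniformOn (rowCanonicalCode π T n μ) ∈ stdSimplex ℝ (ShapeMatrix π n μ) ∧
    IsCapacity q (mmc π N n μ)
      (mutualInfo q (uniformOn (rowCanonicalCode π T n μ)) (mmc π N n μ)) ∧
    -- the rate of the code, used once, is the capacity, and its error probability is zero
    IsCapacity q (mmc π N n μ) (Real.logb q ((rowCanonicalCode π T n μ).ncard : ℝ)) ∧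
    (∃ D : ShapeMatrix π N μ → ShapeMatrix π n μ,
      ∀ X ∈ rowCanonicalCode π T n μ, errorProb (mmc π N n μ) D X = 0) ∧
    -- each submodule that is the row span of some input is the row span of exactly one codeword
    Set.BijOn (fun X : ShapeMatrix π n μ => rowSpan X.1) (rowCanonicalCode π T n μ)
      (Set.range fun X : ShapeMatrix π n μ => rowSpan X.1) := by
  have hq : (1 : ℝ) < q := by exact_mod_cast hR.one_lt
  have hW := isClassChannel_mmc hR hT hnN μ
  have hbij := bijOn_rowCanonicalCode hR hT n μ
  have hne := rowCanonicalCode_nonempty (π := π) T n μ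
  have hcap := hW.isCapacity hq hbij hne
  refine ⟨?_, uniformOn_mem_stdSimplex hne, ?_, ?_, hW.exists_decoder hbij.injOn hne, hbij⟩
  · rwa [← hR.ncard_range_rowSpan n hμ]
  · rwa [hW.mutualInfo_uniformOn hbij hne]
  · rwa [← hbij.injOn.ncard_image, hbij.image_eq]
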